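/- **Conventions.** All rings are commutative, Noetherian, with unity. A ring homomorphism $R\to S$ is a *pure extension* if for every $R$-module $M$ the map $M\to M\otimes_R S$, $m\mapsto m\otimes 1$, is injective. For a closed subset $Z\subseteq\operatorname{Spec}R$ and an $R$-module $M$, let $\Gamma_Z(M)$ be the submodule of the elements of $M$ with support in $Z$, and let $H^i_Z$ be the $i$-th right derived functor of $\Gamma_Z$; for an ideal $I$, $H^i_I=H^i_{V(I)}$. For closed subsets $Z_1\subseteq Z_2$, let $H^i_{Z_1/Z_2}$ be the $i$-th right derived functor of $\Gamma_{Z_2}/\Gamma_{Z_1}$; there is a natural long exact sequence $$\cdots\to H^i_{Z_1}\to H^i_{Z_2}\to H^i_{Z_1/Z_2}\to H^{i+1}_{Z_1}\to\cdots .$$ A *Lyubeznik functor* over $R$ is a composite $T=T_1\circ\cdots\circ T_t$ in which each $T_j$ is either $H^i_Z$ for some $i\ge 0$ and some closed $Z\subseteq\operatorname{Spec}R$, or the kernel, the image or the cokernel of some map in the above long exact sequence for some closed $Z_1\subseteq Z_2$. For an $R$-algebra $S$, $T(S)$ denotes the $S$-module obtained by applying to $S$ the Lyubeznik functor over $S$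 given by the same recipe, with every closed subset replaced by its preimage in $\operatorname{Spec}S$ (so that $V(I)$ is replaced by $V(IS)$). **Theorem 4.1.** Let $R\to S$ be a pure extension of Noetherian rings. (a) Suppose that $R$ is local. Then, for every Lyubeznik functor $T$ over $R$, if $\operatorname{Ass}_S T(S)$ is finite, then $\operatorname{Ass}_R T(R)$ is finite. In particular, for every $i\ge 0$, if $\operatorname{Ass}_S H^i_J(S)$ is finite for every ideal $J\subseteq S$, then $\operatorname{Ass}_R H^i_I(R)$ is finite for every ideal $I\subseteq R$. (b) Without assuming that $R$ is local: for every $i\ge 0$, if $\operatorname{Ass}_S H^i_J(S)$ is finite for every ideal $J\subseteq S$, then $\operatorname{Ass}_R H^i_I(R)$ is finite for every ideal $I\subseteq R$. -/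

import Mathlib

open CategoryTheory CategoryTheory.Limits TensorProduct

universe u

namespace Lyubeznik

noncomputable section

/-- `R → S` is a pure extension: `M → M ⊗[R] S`, `m ↦ m ⊗ 1`, is injective for every `R`-module
`M`. (Taking `M = R` shows that `R → S` itself is injective.) -/
def IsPureExtension (R S : Type u) [CommRing R] [CommRing S] [Algebra R S] : Prop :=
  ∀ (M : Type u) [AddCommGroup M] [Module R M],
    Function.Injective (fun m : M => m ⊗ₜ[R] (1 : S))

section Sections

variable {R : Type u} [CommRing R]

/-- `Γ_Z(M)`: the submodule of the elements of `M` with support in `Z`, i.e. of those `m` such that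
every prime containing the annihilator of `m` lies in `Z`. -/
def sections (Z : TopologicalSpace.Closeds (PrimeSpectrum R)) (M : Type u) [AddCommGroup M]
    [Module R M] : Submodule R M where
  carrier := {m | PrimeSpectrum.zeroLocus (Ideal.torsionOf R M m : Set R) ⊆ Z}
  zero_mem' := by
    intro p hp
    have h1 : (1 : R) ∈ p.asIdeal := hp (by simp)
    exact absurd h1 ((Ideal.ne_top_iff_one _).mp p.isPrime.ne_top)
  add_mem' := by
    intro a b ha hb p hp
    have h : Ideal.torsionOf R M a ⊓ Ideal.torsionOf R M b ≤ p.asIdeal := by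
      rintro r ⟨h1, h2⟩
      refine hp ?_
      simp only [SetLike.mem_coe, Ideal.mem_torsionOf_iff] at h1 h2 ⊢
      rw [smul_add, h1, h2, add_zero]
    rcases p.isPrime.inf_le.mp h with h | h
    · exact ha h
    · exact hb h
  smul_mem' := by
    intro c m hm p hp
    refine hm fun r hr => hp ?_
    simp only [SetLike.mem_coe, Ideal.mem_torsionOf_iff] at hr ⊢
    rw [smul_comm, hr, smul_zero]

theorem sections_mono {Z₁ Z₂ : TopologicalSpace.Closeds (PrimeSpectrum R)} (h : Z₁ ≤ Z₂)
    (M : Type u) [AddCommGroup M] [Module R M] : sections Z₁ M ≤ sections Z₂ M :=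
  fun _ hm => Set.Subset.trans hm h

theorem map_mem_sections (Z : TopologicalSpace.Closeds (PrimeSpectrum R)) {M N : Type u}
    [AddCommGroup M] [Module R M] [AddCommGroup N] [Module R N] (f : M →ₗ[R] N) {m : M}
    (hm : m ∈ sections Z M) : f m ∈ sections Z N := by
  intro p hp
  refine hm fun r hr => hp ?_
  simp only [SetLike.mem_coe, Ideal.mem_torsionOf_iff] at hr ⊢
  rw [← map_smul, hr, map_zero]

/-- The functor `Γ_Z` on `R`-modules. -/
def sectionsFunctor (Z : TopologicalSpace.Closeds (PrimeSpectrum R)) :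
    ModuleCat.{u} R ⥤ ModuleCat.{u} R where
  obj M := ModuleCat.of R (sections Z M)
  map f := ModuleCat.ofHom (f.hom.restrict fun _ hm => map_mem_sections Z f.hom hm)

instance (Z : TopologicalSpace.Closeds (PrimeSpectrum R)) : (sectionsFunctor Z).Additive where

variable (Z₁ Z₂ : TopologicalSpace.Closeds (PrimeSpectrum R))

/-- The functor `Γ_{Z₁/Z₂} = Γ_{Z₂} / Γ_{Z₁}`, for closed subsets `Z₁ ⊆ Z₂`. -/
def relSectionsFunctor : ModuleCat.{u} R ⥤ ModuleCat.{u} R where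
  obj M := ModuleCat.of R (sections Z₂ M ⧸ (sections Z₁ M).submoduleOf (sections Z₂ M))
  map f := ModuleCat.ofHom (Submodule.mapQ _ _
    (f.hom.restrict fun _ hm => map_mem_sections Z₂ f.hom hm)
    fun _ hm => map_mem_sections Z₁ f.hom hm)
  map_id M := by
    ext x
    rfl
  map_comp f g := by
    ext x
    rfl

instance : (relSectionsFunctor Z₁ Z₂).Additive where
  map_add {M N f g} := by
    ext x
    obtain ⟨x, rfl⟩ := Submodule.Quotient.mk_surjective _ x
    rfl

variable {Z₁ Z₂}

/-- The inclusion `Γ_{Z₁} → Γ_{Z₂}`. -/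
def sectionsIncl (h : Z₁ ≤ Z₂) : sectionsFunctor Z₁ ⟶ sectionsFunctor Z₂ where
  app M := ModuleCat.ofHom (Submodule.inclusion (sections_mono h M))

variable (Z₁ Z₂) in
/-- The projection `Γ_{Z₂} → Γ_{Z₁/Z₂}`. -/
def sectionsProj : sectionsFunctor Z₂ ⟶ relSectionsFunctor Z₁ Z₂ where
  app M := ModuleCat.ofHom (Submodule.mkQ _)

theorem sectionsIncl_comp_sectionsProj (h : Z₁ ≤ Z₂) :
    sectionsIncl h ≫ sectionsProj Z₁ Z₂ = 0 := by
  ext M x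
  exact (Submodule.Quotient.mk_eq_zero _).mpr x.2

/-- `0 → Γ_{Z₁}(M) → Γ_{Z₂}(M) → Γ_{Z₁/Z₂}(M) → 0`, applied to a complex `K` of modules. -/
def sectionsShortComplex (h : Z₁ ≤ Z₂) (K : CochainComplex (ModuleCat.{u} R) ℕ) :
    ShortComplex (CochainComplex (ModuleCat.{u} R) ℕ) where
  X₁ := ((sectionsFunctor Z₁).mapHomologicalComplex _).obj K
  X₂ := ((sectionsFunctor Z₂).mapHomologicalComplex _).obj K
  X₃ := ((relSectionsFunctor Z₁ Z₂).mapHomologicalComplex _).obj K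
  f := (NatTrans.mapHomologicalComplex (sectionsIncl h) _).app K
  g := (NatTrans.mapHomologicalComplex (sectionsProj Z₁ Z₂) _).app K
  zero := by
    ext n : 1
    exact NatTrans.congr_app (sectionsIncl_comp_sectionsProj h) (K.X n)

theorem sectionsShortComplex_shortExact (h : Z₁ ≤ Z₂) (K : CochainComplex (ModuleCat.{u} R) ℕ) :
    (sectionsShortComplex h K).ShortExact := by
  refine HomologicalComplex.shortExact_of_degreewise_shortExact _ fun n => ?_
  refine ShortComplex.ShortExact.mk' ?_ ?_ ?_
  · rw [ShortComplex.moduleCat_exact_iff]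
    intro x hx
    exact ⟨⟨x.1, (Submodule.Quotient.mk_eq_zero
      ((sections Z₁ (K.X n)).submoduleOf (sections Z₂ (K.X n)))).mp hx⟩, rfl⟩
  · exact (ModuleCat.mono_iff_injective _).mpr (Submodule.inclusion_injective (sections_mono h _))
  · exact (ModuleCat.epi_iff_surjective _).mpr (Submodule.mkQ_surjective _)

/-- `sectionsShortComplex` is functorial in the complex. -/
def sectionsShortComplexMap (h : Z₁ ≤ Z₂) {K L : CochainComplex (ModuleCat.{u} R) ℕ} (φ : K ⟶ L) :
    sectionsShortComplex h K ⟶ sectionsShortComplex h L where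
  τ₁ := ((sectionsFunctor Z₁).mapHomologicalComplex _).map φ
  τ₂ := ((sectionsFunctor Z₂).mapHomologicalComplex _).map φ
  τ₃ := ((relSectionsFunctor Z₁ Z₂).mapHomologicalComplex _).map φ
  comm₁₂ := (NatTrans.mapHomologicalComplex (sectionsIncl h) _).naturality φ
  comm₂₃ := (NatTrans.mapHomologicalComplex (sectionsProj Z₁ Z₂) _).naturality φ

variable (Z₁ Z₂)

/-- Local cohomology `H^i_Z` with support in the closed set `Z`: the `i`-th right derived functor
of `Γ_Z`. -/
abbrev cohomology (Z : TopologicalSpace.Closeds (PrimeSpectrum R)) (i : ℕ) :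
    ModuleCat.{u} R ⥤ ModuleCat.{u} R :=
  (sectionsFunctor Z).rightDerived i

/-- Relative local cohomology `H^i_{Z₁/Z₂}`: the `i`-th right derived functor of `Γ_{Z₁/Z₂}`. -/
abbrev relCohomology (i : ℕ) : ModuleCat.{u} R ⥤ ModuleCat.{u} R :=
  (relSectionsFunctor Z₁ Z₂).rightDerived i

/-- The local cohomology module `H^i_I(M)` at an ideal `I`, i.e. with support in `V(I)`. -/
def idealCohomology (I : Ideal R) (i : ℕ) (M : ModuleCat.{u} R) : ModuleCat.{u} R :=
  (cohomology ⟨PrimeSpectrum.zeroLocus (I : Set R), PrimeSpectrum.isClosed_zeroLocus _⟩ i).obj M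

variable {Z₁ Z₂}

/-- The connecting map in cohomology of `0 → Γ_{Z₁}(K) → Γ_{Z₂}(K) → Γ_{Z₁/Z₂}(K) → 0`. -/
def complexConnecting (h : Z₁ ≤ Z₂) (i : ℕ) (K : CochainComplex (ModuleCat.{u} R) ℕ) :
    (HomologicalComplex.homologyFunctor _ _ i).obj
        (((relSectionsFunctor Z₁ Z₂).mapHomologicalComplex _).obj K) ⟶
      (HomologicalComplex.homologyFunctor _ _ (i + 1)).obj
        (((sectionsFunctor Z₁).mapHomologicalComplex (ComplexShape.up ℕ)).obj K) :=
  (sectionsShortComplex_shortExact h K).δ i (i + 1) (by simp)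

theorem complexConnecting_naturality (h : Z₁ ≤ Z₂) (i : ℕ)
    {K L : CochainComplex (ModuleCat.{u} R) ℕ} (φ : K ⟶ L) :
    complexConnecting h i K ≫ ((sectionsFunctor Z₁).mapHomologicalComplex _ ⋙
        HomologicalComplex.homologyFunctor _ _ (i + 1)).map φ =
      ((relSectionsFunctor Z₁ Z₂).mapHomologicalComplex _ ⋙
        HomologicalComplex.homologyFunctor _ _ i).map φ ≫ complexConnecting h i L :=
  HomologicalComplex.HomologySequence.δ_naturality (sectionsShortComplexMap h φ)
    (sectionsShortComplex_shortExact h K) (sectionsShortComplex_shortExact h L) i (i + 1) (by simp)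

/-- The connecting map `H^i_{Z₁/Z₂} → H^{i+1}_{Z₁}`: evaluated at `M`, the connecting map of
`0 → Γ_{Z₁}(K) → Γ_{Z₂}(K) → Γ_{Z₁/Z₂}(K) → 0` with `K` an injective resolution of `M`. -/
def connecting (h : Z₁ ≤ Z₂) (i : ℕ) : relCohomology Z₁ Z₂ i ⟶ cohomology Z₁ (i + 1) where
  app M :=
    ((injectiveResolution M).isoRightDerivedObj (relSectionsFunctor Z₁ Z₂) i).hom ≫
      complexConnecting h i (injectiveResolution M).cocomplex ≫
      ((injectiveResolution M).isoRightDerivedObj (sectionsFunctor Z₁) (i + 1)).inv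
  naturality M N f := by
    have w := InjectiveResolution.desc_commutes_zero f (injectiveResolution N)
      (injectiveResolution M)
    have h1 := InjectiveResolution.isoRightDerivedObj_hom_naturality f (injectiveResolution M)
      (injectiveResolution N) _ w (relSectionsFunctor Z₁ Z₂) i
    have h2 := InjectiveResolution.isoRightDerivedObj_inv_naturality f (injectiveResolution M)
      (injectiveResolution N) _ w (sectionsFunctor Z₁) (i + 1)
    have h3 := complexConnecting_naturality h i
      (InjectiveResolution.desc f (injectiveResolution N) (injectiveResolution M))
    rw [Functor.comp_map] at h1 h2 h3
    rw [Functor.comp_map] at h3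
    rw [Category.assoc, Category.assoc, h2, reassoc_of% h1, reassoc_of% h3]

/-- The three kinds of maps in the long exact sequence
`⋯ → H^i_{Z₁} → H^i_{Z₂} → H^i_{Z₁/Z₂} → H^{i+1}_{Z₁} → ⋯`. -/
inductive MapKind where
  | incl
  | proj
  | conn

/-- The source of a map in the long exact sequence. -/
abbrev MapKind.source (Z₁ Z₂ : TopologicalSpace.Closeds (PrimeSpectrum R)) (i : ℕ) :
    MapKind → (ModuleCat.{u} R ⥤ ModuleCat.{u} R)
  | incl => cohomology Z₁ i
  | proj => cohomology Z₂ i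
  | conn => relCohomology Z₁ Z₂ i

/-- The target of a map in the long exact sequence. -/
abbrev MapKind.target (Z₁ Z₂ : TopologicalSpace.Closeds (PrimeSpectrum R)) (i : ℕ) :
    MapKind → (ModuleCat.{u} R ⥤ ModuleCat.{u} R)
  | incl => cohomology Z₂ i
  | proj => relCohomology Z₁ Z₂ i
  | conn => cohomology Z₁ (i + 1)

/-- The maps in the long exact sequence. -/
def MapKind.map (h : Z₁ ≤ Z₂) (i : ℕ) :
    (k : MapKind) → (k.source Z₁ Z₂ i ⟶ k.target Z₁ Z₂ i)
  | incl => NatTrans.rightDerived (sectionsIncl h) i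
  | proj => NatTrans.rightDerived (sectionsProj Z₁ Z₂) i
  | conn => connecting h i

end Sections

/-- The data of one factor of a Lyubeznik functor over `R`: a local cohomology functor `H^i_Z`, or
the kernel, image or cokernel of a map in the long exact sequence of closed subsets `Z₁ ⊆ Z₂`. -/
inductive Factor (R : Type u) [CommRing R] : Type u where
  | coh (Z : TopologicalSpace.Closeds (PrimeSpectrum R)) (i : ℕ)
  | ker (Z₁ Z₂ : TopologicalSpace.Closeds (PrimeSpectrum R)) (h : Z₁ ≤ Z₂) (k : MapKind) (i : ℕ)
  | im (Z₁ Z₂ : TopologicalSpace.Closeds (PrimeSpectrum R)) (h : Z₁ ≤ Z₂) (k : MapKind) (i : ℕ)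
  | coker (Z₁ Z₂ : TopologicalSpace.Closeds (PrimeSpectrum R)) (h : Z₁ ≤ Z₂) (k : MapKind) (i : ℕ)

/-- The functor given by a factor. -/
def Factor.functor {R : Type u} [CommRing R] : Factor R → (ModuleCat.{u} R ⥤ ModuleCat.{u} R)
  | coh Z i => cohomology Z i
  | ker _ _ h k i => kernel (k.map h i)
  | im _ _ h k i => image (k.map h i)
  | coker _ _ h k i => cokernel (k.map h i)

/-- The preimage of a closed subset of `Spec R` in `Spec S`; the preimage of `V(I)` is `V(IS)`. -/
def preimage {R : Type u} [CommRing R] (S : Type u) [CommRing S] [Algebra R S]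
    (Z : TopologicalSpace.Closeds (PrimeSpectrum R)) :
    TopologicalSpace.Closeds (PrimeSpectrum S) :=
  Z.preimage (PrimeSpectrum.continuous_comap (algebraMap R S))

theorem preimage_mono {R : Type u} [CommRing R] (S : Type u) [CommRing S] [Algebra R S]
    {Z₁ Z₂ : TopologicalSpace.Closeds (PrimeSpectrum R)} (h : Z₁ ≤ Z₂) :
    preimage S Z₁ ≤ preimage S Z₂ :=
  fun _ hp => h hp

/-- The same factor over an `R`-algebra `S`: every closed subset is replaced by its preimage. -/
def Factor.baseChange {R : Type u} [CommRing R] (S : Type u) [CommRing S] [Algebra R S] :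
    Factor R → Factor S
  | coh Z i => coh (preimage S Z) i
  | ker Z₁ Z₂ h k i => ker (preimage S Z₁) (preimage S Z₂) (preimage_mono S h) k i
  | im Z₁ Z₂ h k i => im (preimage S Z₁) (preimage S Z₂) (preimage_mono S h) k i
  | coker Z₁ Z₂ h k i => coker (preimage S Z₁) (preimage S Z₂) (preimage_mono S h) k i

/-- The Lyubeznik functor `T = T₁ ∘ ⋯ ∘ T_t` with the list of factors `[T₁, …, T_t]`
(the identity functor if the list is empty). -/
def lyubeznikFunctor {R : Type u} [CommRing R] : List (Factor R) →
    (ModuleCat.{u} R ⥤ ModuleCat.{u} R)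
  | [] => 𝟭 _
  | F :: L => lyubeznikFunctor L ⋙ F.functor

end

end Lyubeznik

/-!
The finiteness statements reduce to an inclusion. Let `ρ` be the restriction of scalars from
`S`-modules to `R`-modules. For every Lyubeznik functor `T`, with base change `T_S`, there are
maps

  `T(R) ⟶ T(ρ S) ≅ ρ (T_S(S))`

of which the first is injective. Hence `Ass_R T(R)` is contained in `Ass_R ρ(T_S(S))`, and each
prime of the latter is the contraction of a prime of `Ass_S T_S(S)`
(`associatedPrimes_scalars_subset`). The argument needs neither that `R` is local nor a
completion, so the three assertions follow together; the one on ideals is the case `T =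
H^i_{V(I)}`, since the preimage of `V(I)` is `V(IS)`.

*Injectivity.* As `R` is Noetherian and `R → S` is pure, `R` is a direct summand of each finitely
generated `R`-submodule `N ⊆ S` containing `1`: a retraction `N → R` is a solution in `R` of a
finite linear system that is solvable in `S` (`IsPureExtension.exists_retraction`). So `T(R) →
T(N)` is split injective. The module `S` is the directed colimit of the `N`, and `T` preserves
filtered colimits (`preservesColimitsOfShape_lyubeznikFunctor`), so `T(R) → T(S)` is injective
(`IsPureExtension.injective_map`).

*Base change.* The isomorphism `T(ρ M) ≅ ρ (T_S(M))` is `nonempty_scalars_lyubeznikFunctor_iso`.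
It comes from `Γ_Z(ρ M) = ρ Γ_{Z'}(M)` for `Z'` the preimage of `Z`, once derived functors are
known to be comparable over the two rings. Kernels, images and cokernels of connecting maps are
rewritten by the long exact sequence in terms of the other maps, so that no compatibility of the
two connecting maps is needed.

*Flabby modules.* Both the preservation of filtered colimits and the base change involve
resolutions which need not be injective: a filtered colimit of injective resolutions, and an
injective resolution over `S` seen over `R`. Their terms satisfy a weaker condition, `IsFlabby`,
which holds for injective modules over a Noetherian ring by the Artin–Rees lemma
(`IsFlabby.of_injective`), passes to filtered colimits and to restrictions of scalars, and
suffices to compute the derived functors of `Γ_Z` and `Γ_{Z₁/Z₂}`: these functors preserve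
quasi-isomorphisms between nonnegative complexes of flabby modules
(`quasiIso_map_sectionsFunctor`, `quasiIso_map_relSectionsFunctor`).
-/

namespace Lyubeznik

open PrimeSpectrum TopologicalSpace

/-! ### Sections with support and flabby modules -/

section Flabby

variable {R : Type u} [CommRing R]

/-- Elementwise description of `Γ_{V(s)}`: every element of `s` acts nilpotently. -/
theorem mem_sections_zeroLocus (s : Set R) (hs : IsClosed (zeroLocus s)) (M : Type u)
    [AddCommGroup M] [Module R M] (m : M) :
    m ∈ sections ⟨zeroLocus s, hs⟩ M ↔ ∀ a ∈ s, ∃ n : ℕ, a ^ n • m = 0 := by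
  change zeroLocus (Ideal.torsionOf R M m : Set R) ⊆ zeroLocus s ↔ _
  rw [← zeroLocus_span s, zeroLocus_subset_zeroLocus_iff, Ideal.span_le]
  refine forall₂_congr fun a _ => ?_
  simp [Ideal.mem_radical_iff, Ideal.mem_torsionOf_iff]

theorem exists_eq_zeroLocus (Z : Closeds (PrimeSpectrum R)) :
    ∃ (s : Set R) (hs : IsClosed (zeroLocus s)), Z = ⟨zeroLocus s, hs⟩ := by
  obtain ⟨s, hs⟩ := (isClosed_iff_zeroLocus _).mp Z.isClosed
  exact ⟨s, hs ▸ Z.isClosed, Closeds.ext hs⟩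

theorem exists_eq_zeroLocus_finset [IsNoetherianRing R] (Z : Closeds (PrimeSpectrum R)) :
    ∃ (s : Finset R) (hs : IsClosed (zeroLocus (s : Set R))),
      Z = ⟨zeroLocus (s : Set R), hs⟩ := by
  obtain ⟨I, hI⟩ := (isClosed_iff_zeroLocus_ideal _).mp Z.isClosed
  obtain ⟨s, rfl⟩ := IsNoetherian.noetherian I
  have h : (Z : Set (PrimeSpectrum R)) = zeroLocus (s : Set R) := by
    rw [hI, Ideal.submodule_span_eq, zeroLocus_span]
  exact ⟨s, h ▸ Z.isClosed, Closeds.ext h⟩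

theorem mem_sections_of_injective (Z : Closeds (PrimeSpectrum R)) {M N : Type u}
    [AddCommGroup M] [Module R M] [AddCommGroup N] [Module R N] (f : M →ₗ[R] N)
    (hf : Function.Injective f) {m : M} (h : f m ∈ sections Z N) : m ∈ sections Z M := by
  intro p hp
  refine h fun r hr => hp ?_
  simp only [SetLike.mem_coe, Ideal.mem_torsionOf_iff] at hr ⊢
  exact hf (by rw [map_smul, hr, map_zero])

/-- A module `M` such that, for every closed `Z` and every `f`, the localization map
`Γ_Z(M) → Γ_Z(M)_f` is surjective. Injective modules over Noetherian rings have this property;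
unlike injectivity it survives restriction of scalars and filtered colimits, and it still makes
`M` acyclic for all the functors `Γ_Z`. -/
def IsFlabby (R : Type u) [CommRing R] (M : Type u) [AddCommGroup M] [Module R M] : Prop :=
  ∀ (Z : Closeds (PrimeSpectrum R)) (f : R), ∀ x ∈ sections Z M,
    ∃ y ∈ sections Z M, ∃ n : ℕ, f ^ n • (x - f • y) = 0

variable {M N P : Type u} [AddCommGroup M] [Module R M] [AddCommGroup N] [Module R N]
  [AddCommGroup P] [Module R P]

theorem IsFlabby.of_linearEquiv (h : IsFlabby R M) (e : M ≃ₗ[R] N) : IsFlabby R N := by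
  intro Z f x hx
  obtain ⟨y, hy, n, hn⟩ := h Z f (e.symm x) (map_mem_sections Z e.symm.toLinearMap hx)
  refine ⟨e y, map_mem_sections Z e.toLinearMap hy, n, ?_⟩
  have := congrArg e hn
  simpa using this

theorem IsFlabby.prod (hM : IsFlabby R M) (hN : IsFlabby R N) : IsFlabby R (M × N) := by
  intro Z f x hx
  obtain ⟨y, hy, n, hn⟩ := hM Z f x.1 (map_mem_sections Z (LinearMap.fst R M N) hx)
  obtain ⟨z, hz, m, hm⟩ := hN Z f x.2 (map_mem_sections Z (LinearMap.snd R M N) hx)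
  refine ⟨(y, z), ?_, n + m, ?_⟩
  · have := add_mem (map_mem_sections Z (LinearMap.inl R M N) hy)
      (map_mem_sections Z (LinearMap.inr R M N) hz)
    simpa using this
  · ext
    · simp only [Prod.smul_fst, Prod.fst_sub, Prod.fst_zero]
      rw [pow_add, mul_comm, mul_smul, hn, smul_zero]
    · simp only [Prod.smul_snd, Prod.snd_sub, Prod.snd_zero]
      rw [pow_add, mul_smul, hm, smul_zero]

/-- The division property iterated: modulo `f`-power torsion, elements of `Γ_Z(M)` are divisible
by every power of `f`. -/
theorem IsFlabby.exists_pow (hM : IsFlabby R M) (Z : Closeds (PrimeSpectrum R)) (f : R) (k : ℕ) :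
    ∀ x ∈ sections Z M, ∃ y ∈ sections Z M, ∃ n : ℕ, f ^ n • (x - f ^ k • y) = 0 := by
  induction k with
  | zero => exact fun x hx => ⟨x, hx, 0, by simp⟩
  | succ k ih =>
    intro x hx
    obtain ⟨y, hy, n, hn⟩ := ih x hx
    obtain ⟨z, hz, m, hm⟩ := hM Z f y hy
    refine ⟨z, hz, n + m, ?_⟩
    have : x - f ^ (k + 1) • z = (x - f ^ k • y) + f ^ k • (y - f • z) := by
      rw [smul_sub, smul_smul, ← pow_succ]; abel
    rw [this, smul_add, pow_add, mul_comm, mul_smul, hn, smul_zero, zero_add, mul_comm, mul_smul,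
      smul_comm (f ^ m), hm, smul_zero, smul_zero]

/-- For a short exact sequence `0 → M → N → P → 0` with `M` flabby, `Γ_Z(N) → Γ_Z(P)` is
surjective. -/
theorem IsFlabby.exists_lift [IsNoetherianRing R] (hM : IsFlabby R M) (i : M →ₗ[R] N)
    (p : N →ₗ[R] P) (hi : Function.Injective i) (hip : Function.Exact i p)
    (hp : Function.Surjective p) (Z : Closeds (PrimeSpectrum R)) :
    ∀ c ∈ sections Z P, ∃ b ∈ sections Z N, p b = c := by
  classical
  -- induction on the number of equations of `Z`: a lift supported in `V(s)` is corrected by an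
  -- element of `Γ_{V(s)}(M)` so as to be killed by a power of the next equation `f`
  obtain ⟨s, hs, rfl⟩ := exists_eq_zeroLocus_finset Z
  induction s using Finset.induction_on with
  | empty =>
    intro c _
    obtain ⟨b, rfl⟩ := hp c
    exact ⟨b, by rw [mem_sections_zeroLocus]; simp, rfl⟩
  | insert f s _ ih =>
    intro c hc
    rw [mem_sections_zeroLocus] at hc
    obtain ⟨b, hb, rfl⟩ := ih (isClosed_zeroLocus _) c (by
      rw [mem_sections_zeroLocus]
      exact fun a ha => hc a (by simpa using Or.inr ha))
    obtain ⟨n, hn⟩ := hc f (by simp)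
    rw [← map_smul] at hn
    obtain ⟨a, ha⟩ := (hip _).mp hn
    have ha' : a ∈ sections ⟨zeroLocus (s : Set R), isClosed_zeroLocus _⟩ M :=
      mem_sections_of_injective _ i hi (by rw [ha]; exact Submodule.smul_mem _ _ hb)
    obtain ⟨a', ha'', m, hm⟩ := hM.exists_pow _ f n a ha'
    have hmem : b - i a' ∈ sections ⟨zeroLocus (s : Set R), isClosed_zeroLocus _⟩ N :=
      sub_mem hb (map_mem_sections _ i ha'')
    refine ⟨b - i a', ?_, by simp [hip.apply_apply_eq_zero]⟩
    rw [mem_sections_zeroLocus] at hmem ⊢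
    intro x hx
    rcases Finset.mem_insert.mp (Finset.mem_coe.mp hx) with rfl | hx
    · refine ⟨m + n, ?_⟩
      have := congrArg i hm
      rw [map_smul, map_sub, map_smul, ha, map_zero, ← smul_sub, smul_smul, ← pow_add] at this
      exact this
    · exact hmem x hx

theorem IsFlabby.of_exact [IsNoetherianRing R] (hM : IsFlabby R M) (hN : IsFlabby R N)
    (i : M →ₗ[R] N) (p : N →ₗ[R] P) (hi : Function.Injective i) (hip : Function.Exact i p)
    (hp : Function.Surjective p) : IsFlabby R P := by
  intro Z f c hc
  obtain ⟨b, hb, rfl⟩ := hM.exists_lift i p hi hip hp Z c hc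
  obtain ⟨y, hy, n, hn⟩ := hN Z f b hb
  refine ⟨p y, map_mem_sections Z p hy, n, ?_⟩
  rw [← map_smul p, ← map_sub, ← map_smul, hn, map_zero]

/-- An exact sequence `0 → X₀ → X₁ → ⋯` of flabby modules stays exact after applying `Γ_Z`. -/
theorem exists_sections_preimage_of_exact [IsNoetherianRing R] (X : ℕ → Type u)
    [∀ n, AddCommGroup (X n)] [∀ n, Module R (X n)] (d : ∀ n, X n →ₗ[R] X (n + 1))
    (hX : ∀ n, IsFlabby R (X n)) (h0 : Function.Injective (d 0))
    (hd : ∀ n, Function.Exact (d n) (d (n + 1))) (Z : Closeds (PrimeSpectrum R)) (n : ℕ)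
    (x : X (n + 1)) (hx : x ∈ sections Z (X (n + 1))) (hdx : d (n + 1) x = 0) :
    ∃ y ∈ sections Z (X n), d n y = x := by
  -- the images of the differentials are flabby, being quotients of flabby modules by flabby ones
  have key : ∀ n, IsFlabby R (LinearMap.range (d n)) ∧
      ∀ c ∈ sections Z (LinearMap.range (d n)), ∃ b ∈ sections Z (X n), (d n).rangeRestrict b = c := by
    intro n
    induction n with
    | zero =>
      refine ⟨(hX 0).of_linearEquiv (LinearEquiv.ofInjective (d 0) h0), fun c hc => ?_⟩
      obtain ⟨b, rfl⟩ := LinearMap.surjective_rangeRestrict (d 0) c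
      exact ⟨b, mem_sections_of_injective Z _
        (fun a b h => h0 (congrArg Subtype.val h)) hc, rfl⟩
    | succ n ih =>
      have hex : Function.Exact (LinearMap.range (d n)).subtype (d (n + 1)).rangeRestrict := by
        intro y
        rw [← LinearMap.mem_ker, LinearMap.ker_rangeRestrict, LinearMap.mem_ker, hd n y]
        simp
      exact ⟨ih.1.of_exact (hX _) _ _ (Submodule.subtype_injective _) hex
        (LinearMap.surjective_rangeRestrict _),
        ih.1.exists_lift _ _ (Submodule.subtype_injective _) hex
        (LinearMap.surjective_rangeRestrict _) Z⟩
  obtain ⟨y, hy⟩ := (hd n x).mp hdx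
  obtain ⟨b, hb, hb'⟩ := (key n).2 ⟨x, y, hy⟩
    (mem_sections_of_injective Z (LinearMap.range (d n)).subtype (Submodule.subtype_injective _) hx)
  exact ⟨b, hb, congrArg Subtype.val hb'⟩

/-- Injective modules over Noetherian rings are flabby. Given `x ∈ Γ_{V(I)}(M)`, say with
`Iⁿ x = 0`, the rule `f ^ (k + 1) r + a ↦ f ^ k r x` is well defined on `(f ^ (k + 1)) + I ^ m` for
large `k` and `m`, by the Artin–Rees lemma; the value at `1` of an extension of this map is the
required element. -/
theorem IsFlabby.of_injective [IsNoetherianRing R] (hM : Module.Injective R M) :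
    IsFlabby R M := by
  intro Z f x hx
  obtain ⟨I, hI⟩ := (isClosed_iff_zeroLocus_ideal _).mp Z.isClosed
  have hZ : IsClosed (zeroLocus (I : Set R)) := isClosed_zeroLocus _
  obtain rfl : Z = ⟨zeroLocus (I : Set R), hZ⟩ := Closeds.ext hI
  -- a power of `I` kills `x`
  obtain ⟨n, hn⟩ : ∃ n, I ^ n ≤ Ideal.torsionOf R M x := by
    refine Ideal.exists_pow_le_of_le_radical_of_fg ?_ (IsNoetherian.noetherian I)
    intro a ha
    obtain ⟨n, hn⟩ := (mem_sections_zeroLocus _ _ _ _).mp hx a ha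
    exact ⟨n, (Ideal.mem_torsionOf_iff _ _).mpr hn⟩
  -- the annihilators of the powers of `f` stabilize
  obtain ⟨k, hk⟩ : ∃ k : ℕ, ∀ r : R, f ^ (k + 1) * r = 0 → f ^ k * r = 0 := by
    let A : ℕ →o Ideal R :=
      { toFun := fun k => LinearMap.ker (LinearMap.mulLeft R (f ^ k))
        monotone' := monotone_nat_of_le_succ fun k r hr => by
          simp only [LinearMap.mem_ker, LinearMap.mulLeft_apply] at hr ⊢
          rw [pow_succ', mul_assoc, hr, mul_zero] }
    obtain ⟨k, hk⟩ := monotone_stabilizes_iff_noetherian.mpr ‹IsNoetherianRing R› A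
    refine ⟨k, fun r hr => ?_⟩
    have : r ∈ A k := by rw [hk (k + 1) (Nat.le_succ k)]; exact hr
    exact this
  obtain ⟨c, hc⟩ := I.exists_pow_inf_eq_pow_smul (Ideal.span {f ^ (k + 1)} : Submodule R R)
  let φ : R × (I ^ (n + c) : Ideal R) →ₗ[R] R :=
    (LinearMap.mulLeft R (f ^ (k + 1))).coprod (Submodule.subtype _)
  let ψ : R × (I ^ (n + c) : Ideal R) →ₗ[R] M :=
    (LinearMap.toSpanSingleton R M (f ^ k • x)).comp (LinearMap.fst R R _)
  have hker : LinearMap.ker φ ≤ LinearMap.ker ψ := by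
    rintro ⟨r, a, ha⟩ h
    simp only [LinearMap.mem_ker, φ, ψ, LinearMap.coprod_apply, LinearMap.mulLeft_apply,
      Submodule.subtype_apply, LinearMap.comp_apply, LinearMap.fst_apply,
      LinearMap.toSpanSingleton_apply] at h ⊢
    have h1 : f ^ (k + 1) * r ∈ I ^ (n + c) • (⊤ : Submodule R R) ⊓ Ideal.span {f ^ (k + 1)} := by
      refine ⟨?_, Ideal.mem_span_singleton.mpr (Dvd.intro _ rfl)⟩
      rw [eq_neg_of_add_eq_zero_left h, smul_eq_mul, Ideal.mul_top]
      exact neg_mem ha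
    rw [hc (n + c) (Nat.le_add_left c n), Nat.add_sub_cancel] at h1
    have h2 : f ^ (k + 1) * r ∈ I ^ n * Ideal.span {f ^ (k + 1)} :=
      Submodule.smul_mono le_rfl inf_le_right h1
    obtain ⟨s, hs, hs'⟩ := Ideal.mem_mul_span_singleton.mp h2
    have h3 := hk (r - s) (by rw [mul_sub, ← hs', mul_comm s, sub_self])
    have h4 : s • x = 0 := (Ideal.mem_torsionOf_iff _ _).mp (hn hs)
    have h5 : f ^ k * r = f ^ k * s := by rw [← sub_eq_zero, ← mul_sub, h3]
    rw [smul_smul, mul_comm, h5, mul_smul, h4, smul_zero]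
  obtain ⟨h, hh⟩ := hM.out ((LinearMap.ker φ).liftQ φ le_rfl)
    (LinearMap.ker_eq_bot.mp (Submodule.ker_liftQ_eq_bot _ _ _ le_rfl))
    ((LinearMap.ker φ).liftQ ψ hker)
  have hh' : ∀ z, h (φ z) = ψ z := fun z => hh (Submodule.Quotient.mk z)
  refine ⟨h 1, ?_, k, ?_⟩
  · rw [mem_sections_zeroLocus]
    intro a ha
    refine ⟨n + c, ?_⟩
    have := hh' (0, ⟨a ^ (n + c), Ideal.pow_mem_pow ha _⟩)
    simpa [φ, ψ, ← map_smul] using this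
  · have := hh' (1, 0)
    simp only [φ, ψ, LinearMap.coprod_apply, LinearMap.mulLeft_apply, map_zero, mul_one, add_zero,
      LinearMap.comp_apply, LinearMap.fst_apply, LinearMap.toSpanSingleton_apply, one_smul] at this
    rw [smul_sub, smul_smul, ← pow_succ, ← map_smul, smul_eq_mul, mul_one, this, sub_self]

variable (S : Type u) [CommRing S] [Algebra R S]

/-- The support condition on an element of an `S`-module can be tested over `R`. -/
theorem mem_sections_preimage_iff (Z : Closeds (PrimeSpectrum R)) (M : Type u) [AddCommGroup M]
    [Module R M] [Module S M] [IsScalarTower R S M] (m : M) :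
    m ∈ sections (preimage S Z) M ↔ m ∈ sections Z M := by
  obtain ⟨s, hs, rfl⟩ := exists_eq_zeroLocus Z
  have : preimage S ⟨zeroLocus s, hs⟩ =
      ⟨zeroLocus (algebraMap R S '' s), isClosed_zeroLocus _⟩ :=
    Closeds.ext (preimage_comap_zeroLocus (algebraMap R S) s)
  rw [this, mem_sections_zeroLocus, mem_sections_zeroLocus, Set.forall_mem_image]
  simp only [← map_pow, algebraMap_smul]

theorem IsFlabby.restrictScalars (M : Type u) [AddCommGroup M]
    [Module R M] [Module S M] [IsScalarTower R S M] (hM : IsFlabby S M) : IsFlabby R M := by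
  intro Z f x hx
  obtain ⟨y, hy, n, hn⟩ :=
    hM (preimage S Z) (algebraMap R S f) x ((mem_sections_preimage_iff S Z M x).mpr hx)
  refine ⟨y, (mem_sections_preimage_iff S Z M y).mp hy, n, ?_⟩
  simpa only [← map_pow, algebraMap_smul] using hn

end Flabby

end Lyubeznik

namespace Lyubeznik

open TopologicalSpace

/-! ### Quasi-isomorphisms in terms of elements -/

section HomologyElements

variable {R : Type u} [CommRing R]

/-- The homology class of a cycle in a short complex of modules. -/
noncomputable def homologyClass (S : ShortComplex (ModuleCat.{u} R)) :
    LinearMap.ker S.g.hom →ₗ[R] S.homology :=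
  (S.moduleCatCyclesIso.inv ≫ S.homologyπ).hom

theorem homologyClass_surjective (S : ShortComplex (ModuleCat.{u} R)) :
    Function.Surjective (homologyClass S) :=
  (ModuleCat.epi_iff_surjective (S.moduleCatCyclesIso.inv ≫ S.homologyπ)).mp (epi_comp _ _)

theorem homologyClass_eq_zero_iff (S : ShortComplex (ModuleCat.{u} R))
    (x : LinearMap.ker S.g.hom) : homologyClass S x = 0 ↔ ∃ y, S.f y = x.1 := by
  have h : homologyClass S x = S.moduleCatHomologyIso.inv (S.moduleCatLeftHomologyData.π x) :=
    ConcreteCategory.congr_hom S.moduleCatCyclesIso_inv_π x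
  have hinj : Function.Injective S.moduleCatHomologyIso.inv :=
    (ModuleCat.mono_iff_injective _).mp inferInstance
  rw [h]
  refine (map_eq_zero_iff S.moduleCatHomologyIso.inv.hom hinj).trans ?_
  refine (Submodule.Quotient.mk_eq_zero (LinearMap.range S.moduleCatToCycles)).trans ?_
  constructor
  · rintro ⟨y, hy⟩
    exact ⟨y, congrArg Subtype.val hy⟩
  · rintro ⟨y, hy⟩
    exact ⟨y, Subtype.ext hy⟩

theorem homologyMap_homologyClass {S₁ S₂ : ShortComplex (ModuleCat.{u} R)} (φ : S₁ ⟶ S₂)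
    (x : LinearMap.ker S₁.g.hom) (y : LinearMap.ker S₂.g.hom) (h : y.1 = φ.τ₂ x.1) :
    ShortComplex.homologyMap φ (homologyClass S₁ x) = homologyClass S₂ y := by
  have h1 : ShortComplex.homologyMap φ (homologyClass S₁ x) =
      S₂.homologyπ (ShortComplex.cyclesMap φ (S₁.moduleCatCyclesIso.inv x)) :=
    ConcreteCategory.congr_hom (ShortComplex.homologyπ_naturality φ) (S₁.moduleCatCyclesIso.inv x)
  rw [h1]
  refine congrArg S₂.homologyπ ((ModuleCat.mono_iff_injective S₂.iCycles).mp inferInstance ?_)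
  have h2 := ConcreteCategory.congr_hom (ShortComplex.cyclesMap_i φ)
    (S₁.moduleCatCyclesIso.inv x)
  have h3 := ConcreteCategory.congr_hom S₁.moduleCatCyclesIso_inv_iCycles x
  have h4 := ConcreteCategory.congr_hom S₂.moduleCatCyclesIso_inv_iCycles y
  exact h2.trans ((congrArg φ.τ₂ h3).trans (h.symm.trans h4.symm))

theorem isIso_homologyMap_iff {S₁ S₂ : ShortComplex (ModuleCat.{u} R)} (φ : S₁ ⟶ S₂) :
    IsIso (ShortComplex.homologyMap φ) ↔
      (∀ x, S₁.g x = 0 → (∃ y, S₂.f y = φ.τ₂ x) → ∃ y, S₁.f y = x) ∧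
      (∀ z, S₂.g z = 0 → ∃ x, S₁.g x = 0 ∧ ∃ y, S₂.f y = z - φ.τ₂ x) := by
  have hcomm : ∀ x : LinearMap.ker S₁.g.hom, φ.τ₂ x.1 ∈ LinearMap.ker S₂.g.hom := fun x => by
    have := ConcreteCategory.congr_hom φ.comm₂₃ x.1
    have hx : S₁.g x.1 = 0 := x.2
    exact this.trans ((congrArg φ.τ₃ hx).trans (map_zero φ.τ₃.hom))
  have hmap := fun x : LinearMap.ker S₁.g.hom =>
    homologyMap_homologyClass φ x ⟨φ.τ₂ x.1, hcomm x⟩ rfl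
  rw [ConcreteCategory.isIso_iff_bijective]
  refine and_congr ?_ ?_
  · rw [← ModuleCat.mono_iff_injective, ModuleCat.mono_iff_ker_eq_bot, LinearMap.ker_eq_bot']
    constructor
    · intro h x hx hy
      have h0 := h (homologyClass S₁ ⟨x, hx⟩)
        ((hmap ⟨x, hx⟩).trans ((homologyClass_eq_zero_iff _ _).mpr hy))
      exact (homologyClass_eq_zero_iff _ _).mp h0
    · intro h c hc
      obtain ⟨x, rfl⟩ := homologyClass_surjective S₁ c
      exact (homologyClass_eq_zero_iff _ _).mpr
        (h x.1 x.2 ((homologyClass_eq_zero_iff S₂ ⟨φ.τ₂ x.1, hcomm x⟩).mp ((hmap x).symm.trans hc)))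
  · constructor
    · intro h z hz
      obtain ⟨c, hc⟩ := h (homologyClass S₂ ⟨z, hz⟩)
      obtain ⟨x, rfl⟩ := homologyClass_surjective S₁ c
      refine ⟨x.1, x.2, (homologyClass_eq_zero_iff S₂ (⟨z, hz⟩ - ⟨φ.τ₂ x.1, hcomm x⟩)).mp ?_⟩
      rw [map_sub, ← hmap, sub_eq_zero]
      exact hc.symm
    · intro h c
      obtain ⟨z, rfl⟩ := homologyClass_surjective S₂ c
      obtain ⟨x, hx, hy⟩ := h z.1 z.2
      refine ⟨homologyClass S₁ ⟨x, hx⟩, (hmap ⟨x, hx⟩).trans ?_⟩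
      rw [eq_comm, ← sub_eq_zero, ← map_sub]
      exact (homologyClass_eq_zero_iff _ _).mpr hy

variable {K L : CochainComplex (ModuleCat.{u} R) ℕ} (φ : K ⟶ L)

theorem quasiIsoAt_succ_iff (n : ℕ) :
    QuasiIsoAt φ (n + 1) ↔
      (∀ x, K.d (n + 1) (n + 2) x = 0 → (∃ y, L.d n (n + 1) y = φ.f (n + 1) x) →
        ∃ y, K.d n (n + 1) y = x) ∧
      (∀ z, L.d (n + 1) (n + 2) z = 0 → ∃ x, K.d (n + 1) (n + 2) x = 0 ∧
        ∃ y, L.d n (n + 1) y = z - φ.f (n + 1) x) := by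
  rw [quasiIsoAt_iff' φ n (n + 1) (n + 2) (by simp) (by simp), ShortComplex.quasiIso_iff]
  exact isIso_homologyMap_iff _

theorem quasiIsoAt_zero_iff :
    QuasiIsoAt φ 0 ↔
      (∀ x, K.d 0 1 x = 0 → φ.f 0 x = 0 → x = 0) ∧
      (∀ z, L.d 0 1 z = 0 → ∃ x, K.d 0 1 x = 0 ∧ φ.f 0 x = z) := by
  rw [quasiIsoAt_iff' φ 0 0 1 (by simp) (by simp), ShortComplex.quasiIso_iff,
    isIso_homologyMap_iff]
  have hK : ∀ y, K.d 0 0 y = 0 := fun y => by rw [K.shape 0 0 (by simp)]; rfl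
  have hL : ∀ y, L.d 0 0 y = 0 := fun y => by rw [L.shape 0 0 (by simp)]; rfl
  refine and_congr ?_ ?_
  · refine forall₂_congr fun x hx => ?_
    constructor
    · intro h h0
      obtain ⟨y, hy⟩ := h ⟨0, (map_zero _).trans h0.symm⟩
      exact hy.symm.trans (hK y)
    · rintro h ⟨y, hy⟩
      exact ⟨0, (map_zero _).trans (h (hy.symm.trans (hL y))).symm⟩
  · refine forall₂_congr fun z hz => exists_congr fun x => and_congr_right fun hx => ?_
    constructor
    · rintro ⟨y, hy⟩
      exact (sub_eq_zero.mp (hy.symm.trans (hL y))).symm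
    · intro h
      exact ⟨0, (map_zero _).trans (sub_eq_zero.mpr h.symm).symm⟩

end HomologyElements

/-! ### Sections with support preserve quasi-isomorphisms of flabby complexes -/

section Cone

variable {R : Type u} [CommRing R] {K L : CochainComplex (ModuleCat.{u} R) ℕ} (φ : K ⟶ L)

theorem d_d_apply (K : CochainComplex (ModuleCat.{u} R) ℕ) (n : ℕ) (x : K.X n) :
    K.d (n + 1) (n + 2) (K.d n (n + 1) x) = 0 :=
  ConcreteCategory.congr_hom (K.d_comp_d n (n + 1) (n + 2)) x

theorem hom_d_apply (n : ℕ) (x : K.X n) :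
    φ.f (n + 1) (K.d n (n + 1) x) = L.d n (n + 1) (φ.f n x) :=
  (ConcreteCategory.congr_hom (φ.comm n (n + 1)) x).symm

/-- The terms of the mapping cone of `φ : K ⟶ L`, indexed so that `K.X 0` sits in degree `0`. -/
def coneX (K L : CochainComplex (ModuleCat.{u} R) ℕ) : ℕ → ModuleCat.{u} R
  | 0 => K.X 0
  | n + 1 => ModuleCat.of R (K.X (n + 1) × L.X n)

/-- The differential `(x, y) ↦ (d x, φ x - d y)` of the mapping cone of `φ`. -/
def coneD : ∀ n, coneX K L n →ₗ[R] coneX K L (n + 1)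
  | 0 => ((K.d 0 1).hom.prod (φ.f 0).hom : K.X 0 →ₗ[R] K.X 1 × L.X 0)
  | n + 1 =>
    (((K.d (n + 1) (n + 2)).hom.comp (LinearMap.fst R _ _)).prod
      ((φ.f (n + 1)).hom.comp (LinearMap.fst R _ _) -
        (L.d n (n + 1)).hom.comp (LinearMap.snd R _ _)) :
      K.X (n + 1) × L.X n →ₗ[R] K.X (n + 2) × L.X (n + 1))

theorem coneD_zero_apply (x : K.X 0) :
    coneD φ 0 x = ((K.d 0 1 x, φ.f 0 x) : K.X 1 × L.X 0) := rfl

theorem coneD_succ_apply (n : ℕ) (x : K.X (n + 1)) (y : L.X n) :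
    coneD φ (n + 1) (x, y) =
      ((K.d (n + 1) (n + 2) x, φ.f (n + 1) x - L.d n (n + 1) y) : K.X (n + 2) × L.X (n + 1)) := rfl

theorem coneD_succ_eq_zero (n : ℕ) {x : K.X (n + 1)} {y : L.X n}
    (hx : K.d (n + 1) (n + 2) x = 0) (hy : L.d n (n + 1) y = φ.f (n + 1) x) :
    coneD φ (n + 1) (x, y) = 0 :=
  (coneD_succ_apply φ n x y).trans (Prod.ext hx (sub_eq_zero.mpr hy.symm))

theorem coneD_zero_injective (hφ : QuasiIso φ) : Function.Injective (coneD φ 0) := by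
  rw [← LinearMap.ker_eq_bot, LinearMap.ker_eq_bot']
  intro x hx
  have hx' := (coneD_zero_apply φ x).symm.trans hx
  exact ((quasiIsoAt_zero_iff φ).mp (hφ.quasiIsoAt 0)).1 x
    (congrArg Prod.fst hx') (congrArg Prod.snd hx')

theorem coneD_exact (hφ : QuasiIso φ) (n : ℕ) :
    Function.Exact (coneD φ n) (coneD φ (n + 1)) := by
  rintro ⟨x, y⟩
  constructor
  · intro h
    have h' := (coneD_succ_apply φ n x y).symm.trans h
    have h1 : K.d (n + 1) (n + 2) x = 0 := congrArg Prod.fst h'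
    have h2 : φ.f (n + 1) x - L.d n (n + 1) y = 0 := congrArg Prod.snd h'
    obtain ⟨x', rfl⟩ := ((quasiIsoAt_succ_iff φ n).mp (hφ.quasiIsoAt (n + 1))).1 x h1
      ⟨y, (sub_eq_zero.mp h2).symm⟩
    rw [hom_d_apply, ← map_sub] at h2
    cases n with
    | zero =>
      obtain ⟨x'', h3, h4⟩ := ((quasiIsoAt_zero_iff φ).mp (hφ.quasiIsoAt 0)).2 _ h2
      refine ⟨(x' - x'' : K.X 0), ?_⟩
      rw [coneD_zero_apply, map_sub, map_sub, h3, h4, sub_zero, sub_sub_cancel]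
    | succ n =>
      obtain ⟨x'', h3, y'', h4⟩ := ((quasiIsoAt_succ_iff φ n).mp (hφ.quasiIsoAt (n + 1))).2 _ h2
      refine ⟨(x' - x'', y''), ?_⟩
      rw [coneD_succ_apply, map_sub, map_sub, h3, h4, sub_zero]
      refine Prod.ext rfl ?_
      change φ.f (n + 1) x' - φ.f (n + 1) x'' - (φ.f (n + 1) x' - y - φ.f (n + 1) x'') = y
      abel
  · rintro ⟨z, hz⟩
    rw [← hz]
    cases n with
    | zero =>
      exact (coneD_succ_apply φ 0 (K.d 0 1 z) (φ.f 0 z)).trans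
        (Prod.ext (d_d_apply K 0 z) (sub_eq_zero.mpr (hom_d_apply φ 0 z)))
    | succ n =>
      obtain ⟨x, y⟩ := z
      refine (coneD_succ_apply φ (n + 1) (K.d (n + 1) (n + 2) x)
        (φ.f (n + 1) x - L.d n (n + 1) y)).trans ?_
      rw [d_d_apply, hom_d_apply, map_sub, d_d_apply, sub_zero, sub_self]
      rfl

variable [IsNoetherianRing R]

/-- `Γ_Z` preserves quasi-isomorphisms between nonnegative complexes of flabby modules: the mapping
cone is an exact sequence of flabby modules, so it stays exact. -/
theorem quasiIso_map_sectionsFunctor (hK : ∀ n, IsFlabby R (K.X n)) (hL : ∀ n, IsFlabby R (L.X n))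
    (hφ : QuasiIso φ) (Z : Closeds (PrimeSpectrum R)) :
    QuasiIso (((sectionsFunctor Z).mapHomologicalComplex (ComplexShape.up ℕ)).map φ) := by
  have hX : ∀ n, IsFlabby R (coneX K L n) := by
    intro n
    cases n with
    | zero => exact hK 0
    | succ n => exact (hK (n + 1)).prod (hL n)
  have key := exists_sections_preimage_of_exact (fun n => coneX K L n) (coneD φ) hX
    (coneD_zero_injective φ hφ) (coneD_exact φ hφ) Z
  have hpair : ∀ (n : ℕ) (x : K.X (n + 1)) (y : L.X n), x ∈ sections Z (K.X (n + 1)) →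
      y ∈ sections Z (L.X n) → (x, y) ∈ sections Z (K.X (n + 1) × L.X n) := by
    intro n x y hx hy
    have := add_mem (map_mem_sections Z (LinearMap.inl R (K.X (n + 1)) (L.X n)) hx)
      (map_mem_sections Z (LinearMap.inr R (K.X (n + 1)) (L.X n)) hy)
    simpa using this
  have hfst : ∀ (n : ℕ) (w : K.X (n + 1) × L.X n), w ∈ sections Z (K.X (n + 1) × L.X n) →
      w.1 ∈ sections Z (K.X (n + 1)) :=
    fun n w hw => map_mem_sections Z (LinearMap.fst R (K.X (n + 1)) (L.X n)) hw
  have hsnd : ∀ (n : ℕ) (w : K.X (n + 1) × L.X n), w ∈ sections Z (K.X (n + 1) × L.X n) →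
      w.2 ∈ sections Z (L.X n) :=
    fun n w hw => map_mem_sections Z (LinearMap.snd R (K.X (n + 1)) (L.X n)) hw
  rw [quasiIso_iff]
  intro n
  -- cocycles of the form `(x, y)` in the cone encode injectivity, those of the form `(0, y)`
  -- encode surjectivity
  cases n with
  | zero =>
    rw [quasiIsoAt_zero_iff]
    constructor
    · rintro ⟨x, hx⟩ h1 h2
      refine Subtype.ext (coneD_zero_injective φ hφ ?_)
      refine (coneD_zero_apply φ x).trans (Eq.trans ?_ (map_zero (coneD φ 0)).symm)
      exact Prod.ext (congrArg Subtype.val h1) (congrArg Subtype.val h2)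
    · rintro ⟨z, hz⟩ h1
      have h1' : L.d 0 1 z = 0 := congrArg Subtype.val h1
      obtain ⟨x, hx, h2⟩ := key 0 ((0, z) : K.X 1 × L.X 0) (hpair 0 0 z (zero_mem _) hz)
        (coneD_succ_eq_zero φ 0 (map_zero _) (h1'.trans (map_zero _).symm))
      have h2' := (coneD_zero_apply φ x).symm.trans h2
      exact ⟨⟨x, hx⟩, Subtype.ext (congrArg Prod.fst h2'), Subtype.ext (congrArg Prod.snd h2')⟩
  | succ n =>
    rw [quasiIsoAt_succ_iff]
    constructor
    · rintro ⟨x, hx⟩ h1 ⟨⟨y, hy⟩, h2⟩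
      have h1' : K.d (n + 1) (n + 2) x = 0 := congrArg Subtype.val h1
      have h2' : L.d n (n + 1) y = φ.f (n + 1) x := congrArg Subtype.val h2
      obtain ⟨w, hw, h3⟩ := key n ((x, y) : K.X (n + 1) × L.X n) (hpair n x y hx hy)
        (coneD_succ_eq_zero φ n h1' h2')
      cases n with
      | zero =>
        have h3' := (coneD_zero_apply φ w).symm.trans h3
        exact ⟨⟨w, hw⟩, Subtype.ext (congrArg Prod.fst h3')⟩
      | succ n =>
        obtain ⟨w1, w2⟩ := w
        have h3' := (coneD_succ_apply φ n w1 w2).symm.trans h3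
        exact ⟨⟨w1, hfst n (w1, w2) hw⟩, Subtype.ext (congrArg Prod.fst h3')⟩
    · rintro ⟨z, hz⟩ h1
      have h1' : L.d (n + 1) (n + 2) z = 0 := congrArg Subtype.val h1
      obtain ⟨⟨x, y⟩, hw, h2⟩ := key (n + 1) ((0, z) : K.X (n + 2) × L.X (n + 1))
        (hpair _ 0 z (zero_mem _) hz)
        (coneD_succ_eq_zero φ (n + 1) (map_zero _) (h1'.trans (map_zero _).symm))
      have h2' := (coneD_succ_apply φ n x y).symm.trans h2
      have h3 : φ.f (n + 1) x - L.d n (n + 1) y = z := congrArg Prod.snd h2'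
      refine ⟨⟨x, hfst n (x, y) hw⟩, Subtype.ext (congrArg Prod.fst h2'),
        ⟨-y, neg_mem (hsnd n (x, y) hw)⟩, Subtype.ext ?_⟩
      change L.d n (n + 1) (-y) = z - φ.f (n + 1) x
      rw [← h3, map_neg]
      abel

/-- `Γ_{Z₁/Z₂}` preserves quasi-isomorphisms between nonnegative complexes of flabby modules, by the
five lemma. -/
theorem quasiIso_map_relSectionsFunctor (hK : ∀ n, IsFlabby R (K.X n))
    (hL : ∀ n, IsFlabby R (L.X n)) (hφ : QuasiIso φ) {Z₁ Z₂ : Closeds (PrimeSpectrum R)}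
    (h : Z₁ ≤ Z₂) :
    QuasiIso (((relSectionsFunctor Z₁ Z₂).mapHomologicalComplex (ComplexShape.up ℕ)).map φ) :=
  HomologicalComplex.HomologySequence.quasiIso_τ₃ (sectionsShortComplexMap h φ)
    (sectionsShortComplex_shortExact h K) (sectionsShortComplex_shortExact h L)
    (quasiIso_map_sectionsFunctor φ hK hL hφ Z₁) (quasiIso_map_sectionsFunctor φ hK hL hφ Z₂)

end Cone

end Lyubeznik

namespace Lyubeznik

open TopologicalSpace PrimeSpectrum

/-! ### Filtered colimits of modules -/

section FilteredColimits

variable {R : Type u} [CommRing R] {J : Type u} [SmallCategory J] [IsFiltered J]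

/-- Elementwise recognition of filtered colimits of modules. -/
theorem nonempty_isColimit_iff {K : J ⥤ ModuleCat.{u} R} (c : Cocone K) :
    Nonempty (IsColimit c) ↔ (∀ x : c.pt, ∃ j, ∃ y : K.obj j, c.ι.app j y = x) ∧
      ∀ j, ∀ y : K.obj j, c.ι.app j y = 0 → ∃ k, ∃ f : j ⟶ k, K.map f y = 0 := by
  constructor
  · rintro ⟨hc⟩
    refine ⟨fun x => Concrete.isColimit_exists_rep K hc x, fun j y hy => ?_⟩
    obtain ⟨k, f, hf⟩ := (IsColimit.eq_iff' hc y 0).mp (hy.trans (map_zero (c.ι.app j).hom).symm)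
    exact ⟨k, f, hf.trans (map_zero (K.map f).hom)⟩
  · rintro ⟨h1, h2⟩
    have : ReflectsColimitsOfShape J (forget (ModuleCat.{u} R)) :=
      reflectsColimitsOfShape_of_reflectsIsomorphisms
    refine ⟨isColimitOfReflects (forget (ModuleCat.{u} R))
      (Types.FilteredColimit.isColimitOf' _ _ ?_ ?_)⟩
    · intro x
      obtain ⟨j, y, hy⟩ := h1 x
      exact ⟨j, y, hy.symm⟩
    · intro j x y hxy
      obtain ⟨k, f, hf⟩ := h2 j ((x : K.obj j) - (y : K.obj j))
        ((map_sub (c.ι.app j).hom _ _).trans (sub_eq_zero.mpr hxy))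
      exact ⟨k, f, sub_eq_zero.mp ((map_sub (K.map f).hom _ _).symm.trans hf)⟩

theorem preservesColimitsOfShape_iff {C : Type*} [Category* C] (F : C ⥤ ModuleCat.{u} R) :
    PreservesColimitsOfShape J F ↔ ∀ (K : J ⥤ C) (c : Cocone K), IsColimit c →
      (∀ x : F.obj c.pt, ∃ j, ∃ y : F.obj (K.obj j), F.map (c.ι.app j) y = x) ∧
      ∀ j, ∀ y : F.obj (K.obj j), F.map (c.ι.app j) y = 0 →
        ∃ k, ∃ f : j ⟶ k, F.map (K.map f) y = 0 := by
  constructor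
  · intro _ K c hc
    exact (nonempty_isColimit_iff (F.mapCocone c)).mp ⟨isColimitOfPreserves F hc⟩
  · intro h
    exact ⟨fun {K} => ⟨fun {c} hc => (nonempty_isColimit_iff (F.mapCocone c)).mpr (h K c hc)⟩⟩

/-- A pointwise kernel of functors preserving filtered colimits preserves filtered colimits. -/
theorem preservesColimitsOfShape_of_kernel {C : Type*} [Category* C]
    {H F G : C ⥤ ModuleCat.{u} R} (a : H ⟶ F) (b : F ⟶ G)
    (ha : ∀ X, Function.Injective (a.app X)) (hab : ∀ X, Function.Exact (a.app X) (b.app X))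
    [PreservesColimitsOfShape J F] [PreservesColimitsOfShape J G] :
    PreservesColimitsOfShape J H := by
  rw [preservesColimitsOfShape_iff]
  intro K c hc
  obtain ⟨hF1, hF2⟩ := (preservesColimitsOfShape_iff F).mp inferInstance K c hc
  obtain ⟨-, hG2⟩ := (preservesColimitsOfShape_iff G).mp inferInstance K c hc
  have na : ∀ {X Y : C} (f : X ⟶ Y) (x : H.obj X), a.app Y (H.map f x) = F.map f (a.app X x) :=
    fun f x => ConcreteCategory.congr_hom (a.naturality f) x
  have nb : ∀ {X Y : C} (f : X ⟶ Y) (x : F.obj X), b.app Y (F.map f x) = G.map f (b.app X x) :=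
    fun f x => ConcreteCategory.congr_hom (b.naturality f) x
  constructor
  · intro x
    obtain ⟨j, y, hy⟩ := hF1 (a.app _ x)
    have h1 : G.map (c.ι.app j) (b.app _ y) = 0 :=
      (nb (c.ι.app j) y).symm.trans ((congrArg (b.app _) hy).trans
        ((hab _).apply_apply_eq_zero x))
    obtain ⟨k, f, hf⟩ := hG2 j _ h1
    obtain ⟨z, hz⟩ := (hab _ _).mp ((nb (K.map f) y).trans hf)
    refine ⟨k, z, ha _ ((na (c.ι.app k) z).trans ((congrArg (F.map (c.ι.app k)) hz).trans ?_))⟩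
    have h2 := ConcreteCategory.congr_hom (F.map_comp (K.map f) (c.ι.app k)) y
    rw [c.w] at h2
    exact h2.symm.trans hy
  · intro j y hy
    have h1 : F.map (c.ι.app j) (a.app _ y) = 0 :=
      (na (c.ι.app j) y).symm.trans ((congrArg (a.app _) hy).trans (map_zero (a.app _).hom))
    obtain ⟨k, f, hf⟩ := hF2 j _ h1
    exact ⟨k, f, ha _ ((na (K.map f) y).trans (hf.trans (map_zero (a.app _).hom).symm))⟩

/-- A pointwise cokernel of functors preserving filtered colimits preserves filtered colimits. -/
theorem preservesColimitsOfShape_of_cokernel {C : Type*} [Category* C]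
    {F G H : C ⥤ ModuleCat.{u} R} (a : F ⟶ G) (b : G ⟶ H)
    (hb : ∀ X, Function.Surjective (b.app X)) (hab : ∀ X, Function.Exact (a.app X) (b.app X))
    [PreservesColimitsOfShape J F] [PreservesColimitsOfShape J G] :
    PreservesColimitsOfShape J H := by
  rw [preservesColimitsOfShape_iff]
  intro K c hc
  obtain ⟨hF1, -⟩ := (preservesColimitsOfShape_iff F).mp inferInstance K c hc
  obtain ⟨hG1, hG2⟩ := (preservesColimitsOfShape_iff G).mp inferInstance K c hc
  have na : ∀ {X Y : C} (f : X ⟶ Y) (x : F.obj X), a.app Y (F.map f x) = G.map f (a.app X x) :=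
    fun f x => ConcreteCategory.congr_hom (a.naturality f) x
  have nb : ∀ {X Y : C} (f : X ⟶ Y) (x : G.obj X), b.app Y (G.map f x) = H.map f (b.app X x) :=
    fun f x => ConcreteCategory.congr_hom (b.naturality f) x
  constructor
  · intro x
    obtain ⟨x, rfl⟩ := hb _ x
    obtain ⟨j, y, rfl⟩ := hG1 x
    exact ⟨j, b.app _ y, (nb _ y).symm⟩
  · intro j y hy
    obtain ⟨y, rfl⟩ := hb _ y
    obtain ⟨x, hx⟩ := (hab _ _).mp ((nb (c.ι.app j) y).trans hy)
    obtain ⟨i, z, rfl⟩ := hF1 x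
    -- compare `y` and the image of `z` at a common stage
    let s := IsFiltered.max j i
    let l : j ⟶ s := IsFiltered.leftToMax j i
    let r : i ⟶ s := IsFiltered.rightToMax j i
    have hl : G.map (c.ι.app s) (G.map (K.map l) y) = G.map (c.ι.app j) y := by
      have h2 := ConcreteCategory.congr_hom (G.map_comp (K.map l) (c.ι.app s)) y
      rw [c.w] at h2
      exact h2.symm
    have hr : F.map (c.ι.app s) (F.map (K.map r) z) = F.map (c.ι.app i) z := by
      have h2 := ConcreteCategory.congr_hom (F.map_comp (K.map r) (c.ι.app s)) z
      rw [c.w] at h2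
      exact h2.symm
    have h0 : G.map (c.ι.app s) (G.map (K.map l) y - a.app _ (F.map (K.map r) z)) = 0 := by
      refine (map_sub (G.map (c.ι.app s)).hom _ _).trans (sub_eq_zero.mpr (hl.trans ?_))
      refine Eq.trans ?_ (na (c.ι.app s) (F.map (K.map r) z))
      exact hx.symm.trans (congrArg (a.app _) hr.symm)
    obtain ⟨k, f, hf⟩ := hG2 s _ h0
    refine ⟨k, l ≫ f, ?_⟩
    have h3 : G.map (K.map (l ≫ f)) y = a.app _ (F.map (K.map f) (F.map (K.map r) z)) := by
      have h4 := ConcreteCategory.congr_hom (G.map_comp (K.map l) (K.map f)) y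
      rw [← K.map_comp] at h4
      refine h4.trans ((sub_eq_zero.mp ((map_sub (G.map (K.map f)).hom _ _).symm.trans hf)).trans ?_)
      exact (na (K.map f) (F.map (K.map r) z)).symm
    refine (nb (K.map (l ≫ f)) y).symm.trans ((congrArg (b.app _) h3).trans ?_)
    exact (hab _).apply_apply_eq_zero _

theorem preservesColimitsOfShape_kernel {C : Type*} [Category* C]
    {F G : C ⥤ ModuleCat.{u} R} (b : F ⟶ G)
    [PreservesColimitsOfShape J F] [PreservesColimitsOfShape J G] :
    PreservesColimitsOfShape J (kernel b) := by
  refine preservesColimitsOfShape_of_kernel (kernel.ι b) b (fun X => ?_) (fun X => ?_)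
  · exact (ModuleCat.mono_iff_injective _).mp inferInstance
  · have h : (ShortComplex.mk (kernel.ι b) b (kernel.condition b)).Exact :=
      ShortComplex.exact_of_f_is_kernel _ (kernelIsKernel b)
    exact (ShortComplex.ShortExact.moduleCat_exact_iff_function_exact _).mp
      (h.map ((evaluation C (ModuleCat.{u} R)).obj X))

theorem preservesColimitsOfShape_cokernel {C : Type*} [Category* C]
    {F G : C ⥤ ModuleCat.{u} R} (a : F ⟶ G)
    [PreservesColimitsOfShape J F] [PreservesColimitsOfShape J G] :
    PreservesColimitsOfShape J (cokernel a) := by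
  refine preservesColimitsOfShape_of_cokernel a (cokernel.π a) (fun X => ?_) (fun X => ?_)
  · exact (ModuleCat.epi_iff_surjective _).mp inferInstance
  · have h : (ShortComplex.mk a (cokernel.π a) (cokernel.condition a)).Exact :=
      ShortComplex.exact_of_g_is_cokernel _ (cokernelIsCokernel a)
    exact (ShortComplex.ShortExact.moduleCat_exact_iff_function_exact _).mp
      (h.map ((evaluation C (ModuleCat.{u} R)).obj X))

theorem preservesColimitsOfShape_image {C : Type*} [Category* C]
    {F G : C ⥤ ModuleCat.{u} R} (a : F ⟶ G)
    [PreservesColimitsOfShape J F] [PreservesColimitsOfShape J G] :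
    PreservesColimitsOfShape J (image a) := by
  have := preservesColimitsOfShape_cokernel (J := J) a
  have : PreservesColimitsOfShape J (Abelian.image a) :=
    preservesColimitsOfShape_kernel (cokernel.π a)
  exact preservesColimitsOfShape_of_natIso (Abelian.imageIsoImage a)

theorem toCycles_naturality {K L : CochainComplex (ModuleCat.{u} R) ℕ} (f : K ⟶ L) (p n : ℕ) :
    f.f p ≫ L.toCycles p n = K.toCycles p n ≫ HomologicalComplex.cyclesMap f n := by
  simp [← cancel_mono (L.iCycles n)]

instance preservesColimitsOfShape_homologyFunctor (n : ℕ) :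
    PreservesColimitsOfShape J
      (HomologicalComplex.homologyFunctor (ModuleCat.{u} R) (ComplexShape.up ℕ) n) := by
  let eval := HomologicalComplex.eval (ModuleCat.{u} R) (ComplexShape.up ℕ)
  let cyc := HomologicalComplex.cyclesFunctor (ModuleCat.{u} R) (ComplexShape.up ℕ) n
  have : PreservesColimitsOfShape J cyc := by
    let a : cyc ⟶ eval n := {
      app K := K.iCycles n
      naturality _ _ f := HomologicalComplex.cyclesMap_i f n }
    let b : eval n ⟶ eval (n + 1) := {
      app K := K.d n (n + 1)
      naturality _ _ f := f.comm n (n + 1) }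
    refine preservesColimitsOfShape_of_kernel a b (fun K => ?_) (fun K => ?_)
    · exact (ModuleCat.mono_iff_injective (K.iCycles n)).mp inferInstance
    · exact (ShortComplex.ShortExact.moduleCat_exact_iff_function_exact _).mp
        (ShortComplex.exact_of_f_is_kernel
          (ShortComplex.mk (K.iCycles n) (K.d n (n + 1)) (K.iCycles_d n (n + 1)))
          (K.cyclesIsKernel n (n + 1) (by simp)))
  let p := (ComplexShape.up ℕ).prev n
  let a : eval p ⟶ cyc := {
    app K := K.toCycles p n
    naturality _ _ f := toCycles_naturality f p n }
  let b : cyc ⟶ HomologicalComplex.homologyFunctor (ModuleCat.{u} R) (ComplexShape.up ℕ) n :=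
    { app K := K.homologyπ n
      naturality _ _ f := (HomologicalComplex.homologyπ_naturality f n).symm }
  refine preservesColimitsOfShape_of_cokernel a b (fun K => ?_) (fun K => ?_)
  · exact (ModuleCat.epi_iff_surjective (K.homologyπ n)).mp inferInstance
  · exact (ShortComplex.ShortExact.moduleCat_exact_iff_function_exact _).mp
      (ShortComplex.exact_of_g_is_cokernel
        (ShortComplex.mk (K.toCycles p n) (K.homologyπ n) (K.toCycles_comp_homologyπ p n))
        (K.homologyIsCokernel p n rfl))

omit [IsFiltered J] in
theorem preservesColimitsOfShape_mapHomologicalComplex (F : ModuleCat.{u} R ⥤ ModuleCat.{u} R)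
    [F.Additive] [PreservesColimitsOfShape J F] :
    PreservesColimitsOfShape J (F.mapHomologicalComplex (ComplexShape.up ℕ)) :=
  HomologicalComplex.preservesColimitsOfShape_of_eval _ fun i =>
    inferInstanceAs (PreservesColimitsOfShape J (HomologicalComplex.eval _ _ i ⋙ F))

variable [IsNoetherianRing R]

/-- Over a Noetherian ring, `Γ_Z` preserves filtered colimits: membership in `Γ_Z` is a condition on
finitely many elements of the ring. -/
instance preservesColimitsOfShape_sectionsFunctor (Z : Closeds (PrimeSpectrum R)) :
    PreservesColimitsOfShape J (sectionsFunctor Z) := by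
  classical
  rw [preservesColimitsOfShape_iff]
  intro K c hc
  obtain ⟨s, hs, rfl⟩ := exists_eq_zeroLocus_finset Z
  obtain ⟨h1, h2⟩ := (nonempty_isColimit_iff c).mp ⟨hc⟩
  have hw : ∀ {i j : J} (f : i ⟶ j) (y : K.obj i), c.ι.app j (K.map f y) = c.ι.app i y :=
    fun f y => ConcreteCategory.congr_hom (c.w f) y
  have key : ∀ t : Finset R, ∀ j, ∀ y : K.obj j,
      (∀ a ∈ t, ∃ n : ℕ, a ^ n • (c.ι.app j y : c.pt) = 0) →
      ∃ k, ∃ f : j ⟶ k, ∀ a ∈ t, ∃ n : ℕ, a ^ n • (K.map f y : K.obj k) = 0 := by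
    intro t
    induction t using Finset.induction_on with
    | empty => exact fun j y _ => ⟨j, 𝟙 j, fun a ha => absurd ha (Finset.notMem_empty a)⟩
    | insert a t _ ih =>
      intro j y hy
      obtain ⟨k, f, hf⟩ := ih j y fun b hb => hy b (Finset.mem_insert_of_mem hb)
      obtain ⟨n, hn⟩ := hy a (Finset.mem_insert_self a t)
      obtain ⟨l, g, hg⟩ := h2 k (a ^ n • K.map f y)
        ((map_smul (c.ι.app k).hom _ _).trans ((congrArg (a ^ n • ·) (hw f y)).trans hn))
      have hfg : K.map (f ≫ g) y = K.map g (K.map f y) :=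
        ConcreteCategory.congr_hom (K.map_comp f g) y
      refine ⟨l, f ≫ g, fun b hb => ?_⟩
      rw [hfg]
      rcases Finset.mem_insert.mp hb with rfl | hb
      · exact ⟨n, (map_smul (K.map g).hom _ _).symm.trans hg⟩
      · obtain ⟨m, hm⟩ := hf b hb
        exact ⟨m, (map_smul (K.map g).hom _ _).symm.trans
          ((congrArg (K.map g) hm).trans (map_zero (K.map g).hom))⟩
  constructor
  · rintro ⟨x, hx⟩
    obtain ⟨j, y, rfl⟩ := h1 x
    obtain ⟨k, f, hf⟩ := key s j y ((mem_sections_zeroLocus _ _ _ _).mp hx)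
    exact ⟨k, ⟨K.map f y, (mem_sections_zeroLocus _ _ _ _).mpr hf⟩, Subtype.ext (hw f y)⟩
  · rintro j ⟨y, hy⟩ h
    obtain ⟨k, f, hf⟩ := h2 j y (congrArg Subtype.val h)
    exact ⟨k, f, Subtype.ext hf⟩

theorem preservesColimitsOfShape_relSectionsFunctor {Z₁ Z₂ : Closeds (PrimeSpectrum R)}
    (h : Z₁ ≤ Z₂) : PreservesColimitsOfShape J (relSectionsFunctor Z₁ Z₂) := by
  refine preservesColimitsOfShape_of_cokernel (sectionsIncl h) (sectionsProj Z₁ Z₂)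
    (fun M => Submodule.mkQ_surjective _) (fun M x => ?_)
  refine (Submodule.Quotient.mk_eq_zero _).trans ?_
  constructor
  · intro hx
    exact ⟨⟨x.1, hx⟩, rfl⟩
  · rintro ⟨y, rfl⟩
    exact y.2

end FilteredColimits

end Lyubeznik

namespace Lyubeznik

open TopologicalSpace ZeroObject

/-! ### Resolutions -/

section Resolutions

variable {R : Type u} [CommRing R]

/-- `0 → M → K⁰ → K¹ → ⋯` is exact, where the first map is `ε`. -/
structure IsResolution {M : ModuleCat.{u} R} {K : CochainComplex (ModuleCat.{u} R) ℕ}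
    (ε : M ⟶ K.X 0) : Prop where
  injective : Function.Injective ε
  exact_zero : Function.Exact ε (K.d 0 1)
  exact_succ : ∀ n, Function.Exact (K.d n (n + 1)) (K.d (n + 1) (n + 2))

theorem IsResolution.quasiIso {M : ModuleCat.{u} R} {K L : CochainComplex (ModuleCat.{u} R) ℕ}
    {ε : M ⟶ K.X 0} {η : M ⟶ L.X 0} (hε : IsResolution ε) (hη : IsResolution η) (φ : K ⟶ L)
    (w : ε ≫ φ.f 0 = η) : QuasiIso φ := by
  have w' : ∀ m, φ.f 0 (ε m) = η m := fun m => ConcreteCategory.congr_hom w m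
  rw [quasiIso_iff]
  intro n
  cases n with
  | zero =>
    rw [quasiIsoAt_zero_iff]
    constructor
    · intro x hx hx'
      obtain ⟨m, rfl⟩ := (hε.exact_zero x).mp hx
      rw [w'] at hx'
      rw [hη.injective (hx'.trans (map_zero η.hom).symm)]
      exact map_zero ε.hom
    · intro z hz
      obtain ⟨m, rfl⟩ := (hη.exact_zero z).mp hz
      exact ⟨ε m, hε.exact_zero.apply_apply_eq_zero m, w' m⟩
  | succ n =>
    rw [quasiIsoAt_succ_iff]
    constructor
    · exact fun x hx _ => (hε.exact_succ n x).mp hx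
    · intro z hz
      obtain ⟨y, rfl⟩ := (hη.exact_succ n z).mp hz
      exact ⟨0, map_zero (K.d (n + 1) (n + 2)).hom, y, by
        rw [show φ.f (n + 1) 0 = 0 from map_zero (φ.f (n + 1)).hom, sub_zero]⟩

/-- The augmentation `M ⟶ P⁰` of an injective resolution. -/
noncomputable def augmentation {M : ModuleCat.{u} R} (P : InjectiveResolution M) :
    M ⟶ P.cocomplex.X 0 :=
  P.ι.f 0

theorem isResolution_of_injectiveResolution {M : ModuleCat.{u} R} (P : InjectiveResolution M) :
    IsResolution (augmentation P) where
  injective := (ModuleCat.mono_iff_injective (P.ι.f 0)).mp inferInstance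
  exact_zero := (ShortComplex.ShortExact.moduleCat_exact_iff_function_exact _).mp P.exact₀
  exact_succ n :=
    (ShortComplex.ShortExact.moduleCat_exact_iff_function_exact _).mp (P.exact_succ n)

/-- A resolution by injective modules, as an injective resolution in the sense of Mathlib. -/
noncomputable def IsResolution.injectiveResolution {M : ModuleCat.{u} R}
    {K : CochainComplex (ModuleCat.{u} R) ℕ} {ε : M ⟶ K.X 0} (hε : IsResolution ε)
    (hK : ∀ n, Injective (K.X n)) : InjectiveResolution M where
  cocomplex := K
  injective := hK
  ι := (CochainComplex.fromSingle₀Equiv K M).symm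
    ⟨ε, by ext m; exact hε.exact_zero.apply_apply_eq_zero m⟩
  quasiIso := by
    rw [quasiIso_iff]
    intro n
    cases n with
    | zero =>
      rw [quasiIsoAt_zero_iff, CochainComplex.fromSingle₀Equiv_symm_apply_f_zero]
      constructor
      · intro x _ hx
        exact hε.injective (hx.trans (map_zero ε.hom).symm)
      · intro z hz
        obtain ⟨m, rfl⟩ := (hε.exact_zero z).mp hz
        refine ⟨m, ?_, rfl⟩
        rw [HomologicalComplex.single_obj_d]
        rfl
    | succ n =>
      rw [quasiIsoAt_iff_exactAt _ _ (CochainComplex.exactAt_succ_single_obj _ _),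
        HomologicalComplex.exactAt_iff' _ n (n + 1) (n + 2) (by simp) (by simp)]
      exact (ShortComplex.ShortExact.moduleCat_exact_iff_function_exact _).mpr (hε.exact_succ n)

theorem IsResolution.augmentation_injectiveResolution {M : ModuleCat.{u} R}
    {K : CochainComplex (ModuleCat.{u} R) ℕ} {ε : M ⟶ K.X 0} (hε : IsResolution ε)
    (hK : ∀ n, Injective (K.X n)) : augmentation (hε.injectiveResolution hK) = ε :=
  CochainComplex.fromSingle₀Equiv_symm_apply_f_zero _ _

theorem IsResolution.injectiveResolution_comm {M N : ModuleCat.{u} R}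
    {K L : CochainComplex (ModuleCat.{u} R) ℕ} {ε : M ⟶ K.X 0} {η : N ⟶ L.X 0}
    (hε : IsResolution ε) (hK : ∀ n, Injective (K.X n)) (hη : IsResolution η)
    (hL : ∀ n, Injective (L.X n)) (f : M ⟶ N) (φ : K ⟶ L) (w : ε ≫ φ.f 0 = f ≫ η) :
    (hε.injectiveResolution hK).ι.f 0 ≫ φ.f 0 = f ≫ (hη.injectiveResolution hL).ι.f 0 := by
  have h1 := hε.augmentation_injectiveResolution hK
  have h2 := hη.augmentation_injectiveResolution hL
  exact (congrArg (· ≫ φ.f 0) h1).trans (w.trans (congrArg (f ≫ ·) h2).symm)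

theorem isFlabby_of_injective [IsNoetherianRing R] (M : ModuleCat.{u} R) [hM : Injective M] :
    IsFlabby R M :=
  IsFlabby.of_injective ((Module.injective_iff_injective_object R M).mpr hM)

/-- Comparison of a resolution with a complex of injective modules. -/
theorem IsResolution.exists_hom {M : ModuleCat.{u} R} {K : CochainComplex (ModuleCat.{u} R) ℕ}
    {ε : M ⟶ K.X 0} (hε : IsResolution ε) (P : InjectiveResolution M) :
    ∃ φ : K ⟶ P.cocomplex, ε ≫ φ.f 0 = augmentation P := by
  have : Mono ε := (ModuleCat.mono_iff_injective ε).mpr hε.injective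
  have w0 : ε ≫ K.d 0 1 = 0 := by ext m; exact hε.exact_zero.apply_apply_eq_zero m
  have e0 : (ShortComplex.mk ε (K.d 0 1) w0).Exact :=
    (ShortComplex.ShortExact.moduleCat_exact_iff_function_exact _).mpr hε.exact_zero
  have es : ∀ n, (ShortComplex.mk (K.d n (n + 1)) (K.d (n + 1) (n + 2)) (K.d_comp_d _ _ _)).Exact :=
    fun n => (ShortComplex.ShortExact.moduleCat_exact_iff_function_exact _).mpr (hε.exact_succ n)
  let f0 : K.X 0 ⟶ P.cocomplex.X 0 := Injective.factorThru (augmentation P) ε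
  have hf0 : ε ≫ f0 = augmentation P := Injective.comp_factorThru _ _
  have hw1 : ε ≫ f0 ≫ P.cocomplex.d 0 1 = 0 := by
    rw [reassoc_of% hf0]; exact P.ι_f_zero_comp_complex_d
  let f1 : K.X 1 ⟶ P.cocomplex.X 1 := e0.descToInjective (f0 ≫ P.cocomplex.d 0 1) hw1
  have hf1 : K.d 0 1 ≫ f1 = f0 ≫ P.cocomplex.d 0 1 := e0.comp_descToInjective _ _
  refine ⟨CochainComplex.mkHom _ _ f0 f1 hf1.symm fun n ⟨g, g', w⟩ =>
    ⟨(es n).descToInjective (g' ≫ P.cocomplex.d (n + 1) (n + 2)) ?_, ?_⟩, ?_⟩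
  · change K.d n (n + 1) ≫ g' ≫ P.cocomplex.d (n + 1) (n + 2) = 0
    rw [← reassoc_of% w, P.cocomplex.d_comp_d, comp_zero]
  · exact ((es n).comp_descToInjective _ _).symm
  · exact hf0

end Resolutions

/-! ### Functorial injective resolutions -/

section FunctorialResolution

variable (R : Type u) [CommRing R]

/-- A functorial choice of an injective module containing a given module, obtained from the
functorial factorization of the maps `M ⟶ 0`. -/
noncomputable def functorialInjective : ModuleCat.{u} R ⥤ ModuleCat.{u} R :=
  ({ obj M := Arrow.mk (0 : M ⟶ 0)
     map f := Arrow.homMk f (𝟙 _) (by simp) } : ModuleCat.{u} R ⥤ Arrow (ModuleCat.{u} R)) ⋙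
    (MorphismProperty.functorialFactorizationData
      (MorphismProperty.monomorphisms (ModuleCat.{u} R))
      (MorphismProperty.monomorphisms (ModuleCat.{u} R)).rlp).Z

/-- The embedding of a module into the functorially chosen injective module. -/
noncomputable def toFunctorialInjective : 𝟭 (ModuleCat.{u} R) ⟶ functorialInjective R where
  app M := (MorphismProperty.functorialFactorizationData
    (MorphismProperty.monomorphisms (ModuleCat.{u} R))
    (MorphismProperty.monomorphisms (ModuleCat.{u} R)).rlp).i.app (Arrow.mk (0 : M ⟶ 0))
  naturality M N f := (MorphismProperty.functorialFactorizationData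
    (MorphismProperty.monomorphisms (ModuleCat.{u} R))
    (MorphismProperty.monomorphisms (ModuleCat.{u} R)).rlp).i.naturality
      (Arrow.homMk f (𝟙 _) (by simp) : Arrow.mk (0 : M ⟶ 0) ⟶ Arrow.mk (0 : N ⟶ 0))

instance (M : ModuleCat.{u} R) : Mono ((toFunctorialInjective R).app M) :=
  (MorphismProperty.functorialFactorizationData
    (MorphismProperty.monomorphisms (ModuleCat.{u} R))
    (MorphismProperty.monomorphisms (ModuleCat.{u} R)).rlp).hi _

instance (M : ModuleCat.{u} R) : Injective ((functorialInjective R).obj M) :=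
  inferInstanceAs
    (Injective (IsGrothendieckAbelian.monoMapFactorizationDataRlp.{u} (0 : M ⟶ 0)).Z)

variable {R}

/-- The next differential of the functorial resolution after `f`. -/
noncomputable def resolutionD {F G : ModuleCat.{u} R ⥤ ModuleCat.{u} R} (f : F ⟶ G) :
    G ⟶ cokernel f ⋙ functorialInjective R :=
  cokernel.π f ≫ (Functor.rightUnitor _).inv ≫
    Functor.whiskerLeft (cokernel f) (toFunctorialInjective R)

theorem comp_resolutionD {F G : ModuleCat.{u} R ⥤ ModuleCat.{u} R} (f : F ⟶ G) :
    f ≫ resolutionD f = 0 := by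
  simp [resolutionD]

theorem resolutionD_exact {F G : ModuleCat.{u} R ⥤ ModuleCat.{u} R} (f : F ⟶ G)
    (M : ModuleCat.{u} R) :
    Function.Exact (f.app M) ((resolutionD f).app M) := by
  have h : (ShortComplex.mk f (cokernel.π f) (cokernel.condition f)).Exact :=
    ShortComplex.exact_of_g_is_cokernel _ (cokernelIsCokernel f)
  have h1 := (ShortComplex.ShortExact.moduleCat_exact_iff_function_exact _).mp
    (h.map ((evaluation _ (ModuleCat.{u} R)).obj M))
  have h2 : Function.Injective ((toFunctorialInjective R).app ((cokernel f).obj M)) :=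
    (ModuleCat.mono_iff_injective _).mp inferInstance
  intro x
  refine Iff.trans ?_ (h1 x)
  exact map_eq_zero_iff ((toFunctorialInjective R).app ((cokernel f).obj M)).hom h2

variable (R)

/-- The maps `𝟭 ⟶ X⁰`, `X⁰ ⟶ X¹`, `X¹ ⟶ X²`, … of the functorial resolution. -/
noncomputable def resolutionArrow : ℕ → Arrow (ModuleCat.{u} R ⥤ ModuleCat.{u} R)
  | 0 => Arrow.mk (toFunctorialInjective R)
  | n + 1 => Arrow.mk (resolutionD (resolutionArrow n).hom)

/-- A resolution of the identity functor whose terms take values in injective modules. -/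
noncomputable def resolutionComplex :
    CochainComplex (ModuleCat.{u} R ⥤ ModuleCat.{u} R) ℕ :=
  CochainComplex.of (fun n => (resolutionArrow R n).right)
    (fun n => resolutionD (resolutionArrow R n).hom)
    fun n => comp_resolutionD (resolutionD (resolutionArrow R n).hom)

theorem resolutionComplex_d (n : ℕ) :
    (resolutionComplex R).d n (n + 1) = resolutionD (resolutionArrow R n).hom :=
  CochainComplex.of_d (fun n => (resolutionArrow R n).right)
    (fun n => resolutionD (resolutionArrow R n).hom) n

/-- A functorial injective resolution of modules. -/
noncomputable def resolution : ModuleCat.{u} R ⥤ CochainComplex (ModuleCat.{u} R) ℕ :=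
  (resolutionComplex R).asFunctor

/-- The augmentation of the functorial resolution. -/
noncomputable def resolutionι :
    𝟭 (ModuleCat.{u} R) ⟶ resolution R ⋙ HomologicalComplex.eval _ _ 0 where
  app M := (toFunctorialInjective R).app M
  naturality _ _ f := (toFunctorialInjective R).naturality f

theorem injective_resolution_X (M : ModuleCat.{u} R) (n : ℕ) :
    Injective (((resolution R).obj M).X n) := by
  cases n with
  | zero | succ n => exact inferInstanceAs (Injective ((functorialInjective R).obj _))

theorem isResolution_resolution (M : ModuleCat.{u} R) :
    IsResolution (K := (resolution R).obj M) ((resolutionι R).app M) where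
  injective := (ModuleCat.mono_iff_injective ((toFunctorialInjective R).app M)).mp inferInstance
  exact_zero := by
    change Function.Exact _ (((resolutionComplex R).d 0 1).app M)
    rw [resolutionComplex_d R 0]
    exact resolutionD_exact (toFunctorialInjective R) M
  exact_succ n := by
    change Function.Exact (((resolutionComplex R).d n (n + 1)).app M)
      (((resolutionComplex R).d (n + 1) (n + 1 + 1)).app M)
    rw [resolutionComplex_d, resolutionComplex_d]
    exact resolutionD_exact (resolutionD (resolutionArrow R n).hom) M

end FunctorialResolution

end Lyubeznik

namespace Lyubeznik

open TopologicalSpace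

/-! ### Lyubeznik functors preserve filtered colimits -/

section DerivedColimits

variable {R : Type u} [CommRing R]

/-- `G` preserves quasi-isomorphisms between complexes of flabby modules. -/
def PreservesFlabbyQuasiIso (G : ModuleCat.{u} R ⥤ ModuleCat.{u} R) [G.Additive] : Prop :=
  ∀ ⦃K L : CochainComplex (ModuleCat.{u} R) ℕ⦄ (φ : K ⟶ L), (∀ n, IsFlabby R (K.X n)) →
    (∀ n, IsFlabby R (L.X n)) → QuasiIso φ →
    QuasiIso ((G.mapHomologicalComplex (ComplexShape.up ℕ)).map φ)

/-- The functorial injective resolution at a module. -/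
noncomputable def resolutionAt (M : ModuleCat.{u} R) : InjectiveResolution M :=
  (isResolution_resolution R M).injectiveResolution (injective_resolution_X R M)

/-- The map of functorial injective resolutions induced by a linear map. -/
noncomputable def resolutionAtMap {M N : ModuleCat.{u} R} (f : M ⟶ N) :
    (resolutionAt M).cocomplex ⟶ (resolutionAt N).cocomplex :=
  (resolution R).map f

theorem resolutionAt_comm {M N : ModuleCat.{u} R} (f : M ⟶ N) :
    (resolutionAt M).ι.f 0 ≫ (resolutionAtMap f).f 0 = f ≫ (resolutionAt N).ι.f 0 :=
  IsResolution.injectiveResolution_comm (isResolution_resolution R M)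
    (injective_resolution_X R M) (isResolution_resolution R N) (injective_resolution_X R N) f
    ((resolution R).map f) ((resolutionι R).naturality f).symm

/-- The derived functors of `G` computed by the functorial injective resolution. -/
noncomputable def rightDerivedIsoResolution (G : ModuleCat.{u} R ⥤ ModuleCat.{u} R) [G.Additive]
    (i : ℕ) : G.rightDerived i ≅ resolution R ⋙ G.mapHomologicalComplex (ComplexShape.up ℕ) ⋙
      HomologicalComplex.homologyFunctor _ _ i :=
  NatIso.ofComponents (fun M => (resolutionAt M).isoRightDerivedObj G i)
    (fun {M N} f => InjectiveResolution.isoRightDerivedObj_hom_naturality f (resolutionAt M)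
      (resolutionAt N) (resolutionAtMap f) (resolutionAt_comm f) G i)

variable {J : Type u} [SmallCategory J] [IsFiltered J] [IsNoetherianRing R]

theorem isFlabby_of_isColimit {K : J ⥤ ModuleCat.{u} R} {c : Cocone K} (hc : IsColimit c)
    (hK : ∀ j, IsFlabby R (K.obj j)) : IsFlabby R c.pt := by
  intro Z f x hx
  obtain ⟨j, y, hy⟩ := ((preservesColimitsOfShape_iff (sectionsFunctor Z)).mp inferInstance
    K c hc).1 ⟨x, hx⟩
  obtain ⟨z, hz, n, hn⟩ := hK j Z f y.1 y.2
  have hy' : c.ι.app j y.1 = x := congrArg Subtype.val hy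
  refine ⟨(c.ι.app j).hom z, map_mem_sections Z (c.ι.app j).hom hz, n, ?_⟩
  have h := congrArg (c.ι.app j).hom hn
  rw [map_smul, map_sub, map_smul, map_zero] at h
  rw [← hy']
  exact h

omit [IsNoetherianRing R] in
/-- A filtered colimit of exact sequences of modules is exact. -/
theorem exact_of_isColimit {K L N : J ⥤ ModuleCat.{u} R} (a : K ⟶ L) (b : L ⟶ N)
    {c : Cocone K} {d : Cocone L} {e : Cocone N} (hd : IsColimit d) (he : IsColimit e)
    (α : c.pt ⟶ d.pt) (β : d.pt ⟶ e.pt) (ha : ∀ j, c.ι.app j ≫ α = a.app j ≫ d.ι.app j)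
    (hb : ∀ j, d.ι.app j ≫ β = b.app j ≫ e.ι.app j) (hc : IsColimit c)
    (hab : ∀ j, Function.Exact (a.app j) (b.app j)) : Function.Exact α β := by
  have ha' : ∀ j (x : K.obj j), α (c.ι.app j x) = d.ι.app j (a.app j x) :=
    fun j x => ConcreteCategory.congr_hom (ha j) x
  have hb' : ∀ j (x : L.obj j), β (d.ι.app j x) = e.ι.app j (b.app j x) :=
    fun j x => ConcreteCategory.congr_hom (hb j) x
  obtain ⟨hc1, -⟩ := (nonempty_isColimit_iff c).mp ⟨hc⟩
  obtain ⟨hd1, -⟩ := (nonempty_isColimit_iff d).mp ⟨hd⟩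
  obtain ⟨-, he2⟩ := (nonempty_isColimit_iff e).mp ⟨he⟩
  intro y
  constructor
  · intro hy
    obtain ⟨j, y, rfl⟩ := hd1 y
    rw [hb'] at hy
    obtain ⟨k, f, hf⟩ := he2 j _ hy
    obtain ⟨x, hx⟩ := (hab k (L.map f y)).mp
      ((ConcreteCategory.congr_hom (b.naturality f) y).trans hf)
    refine ⟨c.ι.app k x, (ha' k x).trans ((congrArg (d.ι.app k) hx).trans ?_)⟩
    exact ConcreteCategory.congr_hom (d.w f) y
  · rintro ⟨x, rfl⟩
    obtain ⟨j, x, rfl⟩ := hc1 x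
    rw [ha', hb', (hab j).apply_apply_eq_zero]
    exact map_zero (e.ι.app j).hom

/-- Over a Noetherian ring, the derived functors of a functor preserving filtered colimits and
computable by flabby resolutions preserve filtered colimits: a filtered colimit of injective
resolutions is a flabby resolution of the colimit. -/
theorem preservesColimitsOfShape_rightDerived (G : ModuleCat.{u} R ⥤ ModuleCat.{u} R) [G.Additive]
    [PreservesColimitsOfShape J G] (hG : PreservesFlabbyQuasiIso G) (i : ℕ) :
    PreservesColimitsOfShape J (G.rightDerived i) := by
  have := preservesColimitsOfShape_mapHomologicalComplex (J := J) G
  let H := G.mapHomologicalComplex (ComplexShape.up ℕ) ⋙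
    HomologicalComplex.homologyFunctor (ModuleCat.{u} R) (ComplexShape.up ℕ) i
  have hH : PreservesColimitsOfShape J H := comp_preservesColimitsOfShape _ _
  suffices h : PreservesColimitsOfShape J (resolution R ⋙ H) from
    preservesColimitsOfShape_of_natIso (rightDerivedIsoResolution G i).symm
  refine ⟨fun {K} => ⟨fun {c} hc => ?_⟩⟩
  let d := colimit.cocone (K ⋙ resolution R)
  have hd : IsColimit d := colimit.isColimit _
  have hdn : ∀ n, IsColimit ((HomologicalComplex.eval _ _ n).mapCocone d) :=
    fun n => isColimitOfPreserves _ hd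
  let ψ : d.pt ⟶ (resolution R).obj c.pt := hd.desc ((resolution R).mapCocone c)
  have hψ : ∀ j, d.ι.app j ≫ ψ = (resolution R).map (c.ι.app j) := fun j => hd.fac _ j
  -- the colimit of the resolutions is a flabby resolution of the colimit
  let aug : K ⟶ (K ⋙ resolution R) ⋙ HomologicalComplex.eval _ _ 0 :=
    Functor.whiskerLeft K (resolutionι R)
  let ε : c.pt ⟶ d.pt.X 0 :=
    hc.desc ((Cocone.precompose aug).obj ((HomologicalComplex.eval _ _ 0).mapCocone d))
  have hε : ∀ j, c.ι.app j ≫ ε = aug.app j ≫ (d.ι.app j).f 0 := fun j => hc.fac _ j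
  have hεψ : ε ≫ ψ.f 0 = (resolutionι R).app c.pt := by
    refine hc.hom_ext fun j => ?_
    rw [reassoc_of% hε j]
    exact (congrArg (aug.app j ≫ ·) (congrArg (fun φ => φ.f 0) (hψ j))).trans
      ((resolutionι R).naturality (c.ι.app j)).symm
  let dN : ∀ n, (K ⋙ resolution R) ⋙ HomologicalComplex.eval _ _ n ⟶
      (K ⋙ resolution R) ⋙ HomologicalComplex.eval _ _ (n + 1) := fun n =>
    { app j := ((resolution R).obj (K.obj j)).d n (n + 1)
      naturality _ _ f := ((resolution R).map (K.map f)).comm n (n + 1) }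
  have hres : IsResolution (K := d.pt) ε := by
    refine ⟨?_, ?_, fun n => ?_⟩
    · have h := (isResolution_resolution R c.pt).injective
      rw [← hεψ] at h
      exact Function.Injective.of_comp (f := ψ.f 0) h
    · exact exact_of_isColimit aug (dN 0) (hdn 0) (hdn 1) ε (d.pt.d 0 1) hε
        (fun j => (d.ι.app j).comm 0 1) hc (fun j => (isResolution_resolution R _).exact_zero)
    · exact exact_of_isColimit (dN n) (dN (n + 1)) (hdn (n + 1)) (hdn (n + 2)) (d.pt.d n (n + 1))
        (d.pt.d (n + 1) (n + 2)) (fun j => (d.ι.app j).comm n (n + 1))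
        (fun j => (d.ι.app j).comm (n + 1) (n + 2)) (hdn n)
        (fun j => (isResolution_resolution R _).exact_succ n)
  have hflab : ∀ M n, IsFlabby R (((resolution R).obj M).X n) := fun M n =>
    have := injective_resolution_X R M n
    isFlabby_of_injective _
  have hq : QuasiIso ((G.mapHomologicalComplex (ComplexShape.up ℕ)).map ψ) :=
    hG ψ (fun n => isFlabby_of_isColimit (hdn n) fun j => hflab _ n) (hflab c.pt)
      (hres.quasiIso (isResolution_resolution R c.pt) ψ hεψ)
  have hiso : IsIso (H.map ψ) := (quasiIsoAt_iff_isIso_homologyMap _ i).mp (hq.quasiIsoAt i)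
  have hcol : IsColimit (H.mapCocone d) := isColimitOfPreserves H hd
  refine ⟨IsColimit.ofIsoColimit hcol (Cocone.ext (asIso (H.map ψ)) fun j => ?_)⟩
  exact (H.map_comp _ _).symm.trans (congrArg H.map (hψ j))

instance preservesColimitsOfShape_cohomology (Z : Closeds (PrimeSpectrum R)) (i : ℕ) :
    PreservesColimitsOfShape J (cohomology Z i) :=
  preservesColimitsOfShape_rightDerived _
    (fun _ _ φ hK hL hφ => quasiIso_map_sectionsFunctor φ hK hL hφ Z) i

theorem preservesColimitsOfShape_relCohomology {Z₁ Z₂ : Closeds (PrimeSpectrum R)} (h : Z₁ ≤ Z₂)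
    (i : ℕ) : PreservesColimitsOfShape J (relCohomology Z₁ Z₂ i) :=
  have := preservesColimitsOfShape_relSectionsFunctor (J := J) h
  preservesColimitsOfShape_rightDerived _
    (fun _ _ φ hK hL hφ => quasiIso_map_relSectionsFunctor φ hK hL hφ h) i

theorem preservesColimitsOfShape_mapKind_source {Z₁ Z₂ : Closeds (PrimeSpectrum R)} (h : Z₁ ≤ Z₂)
    (i : ℕ) (k : MapKind) : PreservesColimitsOfShape J (k.source Z₁ Z₂ i) := by
  cases k with
  | incl | proj => exact preservesColimitsOfShape_cohomology _ _
  | conn => exact preservesColimitsOfShape_relCohomology h i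

theorem preservesColimitsOfShape_mapKind_target {Z₁ Z₂ : Closeds (PrimeSpectrum R)} (h : Z₁ ≤ Z₂)
    (i : ℕ) (k : MapKind) : PreservesColimitsOfShape J (k.target Z₁ Z₂ i) := by
  cases k with
  | incl | conn => exact preservesColimitsOfShape_cohomology _ _
  | proj => exact preservesColimitsOfShape_relCohomology h i

theorem preservesColimitsOfShape_factor (F : Factor R) : PreservesColimitsOfShape J F.functor := by
  cases F with
  | coh Z i => exact preservesColimitsOfShape_cohomology Z i
  | ker _ _ h k i =>
    have := preservesColimitsOfShape_mapKind_source (J := J) h i k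
    have := preservesColimitsOfShape_mapKind_target (J := J) h i k
    exact preservesColimitsOfShape_kernel _
  | im _ _ h k i =>
    have := preservesColimitsOfShape_mapKind_source (J := J) h i k
    have := preservesColimitsOfShape_mapKind_target (J := J) h i k
    exact preservesColimitsOfShape_image _
  | coker _ _ h k i =>
    have := preservesColimitsOfShape_mapKind_source (J := J) h i k
    have := preservesColimitsOfShape_mapKind_target (J := J) h i k
    exact preservesColimitsOfShape_cokernel _

/-- Lyubeznik functors over a Noetherian ring preserve filtered colimits. -/
theorem preservesColimitsOfShape_lyubeznikFunctor (T : List (Factor R)) :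
    PreservesColimitsOfShape J (lyubeznikFunctor T) := by
  induction T with
  | nil => exact inferInstanceAs (PreservesColimitsOfShape J (𝟭 (ModuleCat.{u} R)))
  | cons F T ih =>
    have := preservesColimitsOfShape_factor (J := J) F
    exact comp_preservesColimitsOfShape (lyubeznikFunctor T) F.functor

end DerivedColimits

end Lyubeznik

namespace Lyubeznik

open TopologicalSpace

/-! ### Derived functors and restriction of scalars -/

section Comparison

variable (R : Type u) {S : Type u} [CommRing R] [CommRing S] [Algebra R S]

/-- Restriction of scalars along `R → S`. -/
noncomputable abbrev scalars : ModuleCat.{u} S ⥤ ModuleCat.{u} R :=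
  ModuleCat.restrictScalars (algebraMap R S)

/-- The complex of `R`-modules underlying a complex of `S`-modules. -/
noncomputable abbrev scalarsComplex (K : CochainComplex (ModuleCat.{u} S) ℕ) :
    CochainComplex (ModuleCat.{u} R) ℕ :=
  ((scalars R).mapHomologicalComplex _).obj K

/-- Cohomology commutes with restriction of scalars. -/
noncomputable def scalarsHomologyIso (K : CochainComplex (ModuleCat.{u} S) ℕ) (i : ℕ) :
    (scalars R).obj ((HomologicalComplex.homologyFunctor _ _ i).obj K) ≅
      (HomologicalComplex.homologyFunctor _ _ i).obj (scalarsComplex R K) :=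
  ((K.sc i).mapHomologyIso (scalars R)).symm

theorem scalarsHomologyIso_hom_naturality {K L : CochainComplex (ModuleCat.{u} S) ℕ} (f : K ⟶ L)
    (i : ℕ) : (scalars R).map ((HomologicalComplex.homologyFunctor _ _ i).map f) ≫
        (scalarsHomologyIso R L i).hom =
      (scalarsHomologyIso R K i).hom ≫ (HomologicalComplex.homologyFunctor _ _ i).map
        (((scalars R).mapHomologicalComplex _).map f) :=
  ShortComplex.mapHomologyIso_inv_naturality
    ((HomologicalComplex.shortComplexFunctor _ _ i).map f) (scalars R)

theorem isResolution_scalars {N : ModuleCat.{u} S} {K : CochainComplex (ModuleCat.{u} S) ℕ}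
    {ε : N ⟶ K.X 0} (hε : IsResolution ε) :
    IsResolution (K := scalarsComplex R K) ((scalars R).map ε) where
  injective := hε.injective
  exact_zero := hε.exact_zero
  exact_succ := hε.exact_succ

theorem mem_sections_scalars_iff (Z : Closeds (PrimeSpectrum R)) (M : ModuleCat.{u} S) (m : M) :
    m ∈ sections (preimage S Z) M ↔
      (show (scalars R).obj M from m) ∈ sections Z ((scalars R).obj M) :=
  let _ : Module R M := Module.compHom M (algebraMap R S)
  have : IsScalarTower R S M := IsScalarTower.of_algebraMap_smul fun _ _ => rfl
  have h := mem_sections_preimage_iff S Z M m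
  h

theorem isFlabby_scalars (M : ModuleCat.{u} S) (hM : IsFlabby S M) :
    IsFlabby R ((scalars R).obj M) :=
  let _ : Module R M := Module.compHom M (algebraMap R S)
  have : IsScalarTower R S M := IsScalarTower.of_algebraMap_smul fun _ _ => rfl
  have h : IsFlabby R M := IsFlabby.restrictScalars S M hM
  h

variable (F F' : ModuleCat.{u} S ⥤ ModuleCat.{u} S) [F.Additive] [F'.Additive]
  (G G' : ModuleCat.{u} R ⥤ ModuleCat.{u} R) [G.Additive] [G'.Additive]

variable {R F F' G G'}

/-- An isomorphism `ρ F ≅ G ρ`, with `ρ` the restriction of scalars, applied to a complex. -/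
noncomputable def comparisonIso (e : F ⋙ scalars R ≅ scalars R ⋙ G)
    (K : CochainComplex (ModuleCat.{u} S) ℕ) :
    scalarsComplex R ((F.mapHomologicalComplex _).obj K) ≅
      (G.mapHomologicalComplex _).obj (scalarsComplex R K) :=
  (NatIso.mapHomologicalComplex e _).app K

/-- For an isomorphism `e : ρ F ≅ G ρ` with `ρ` the restriction of scalars, and a map `φ : ρ K → L`,
the induced map `ρ (F K) → G L`. -/
noncomputable def comparisonHom (e : F ⋙ scalars R ≅ scalars R ⋙ G)
    {K : CochainComplex (ModuleCat.{u} S) ℕ} {L : CochainComplex (ModuleCat.{u} R) ℕ}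
    (φ : scalarsComplex R K ⟶ L) :
    scalarsComplex R ((F.mapHomologicalComplex _).obj K) ⟶ (G.mapHomologicalComplex _).obj L :=
  (comparisonIso e K).hom ≫ (G.mapHomologicalComplex _).map φ

theorem comparisonHom_naturality (e : F ⋙ scalars R ≅ scalars R ⋙ G)
    (e' : F' ⋙ scalars R ≅ scalars R ⋙ G') (α : F ⟶ F') (β : G ⟶ G')
    (w : ∀ M, (scalars R).map (α.app M) ≫ e'.hom.app M = e.hom.app M ≫ β.app ((scalars R).obj M))
    {K : CochainComplex (ModuleCat.{u} S) ℕ} {L : CochainComplex (ModuleCat.{u} R) ℕ}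
    (φ : scalarsComplex R K ⟶ L) :
    ((scalars R).mapHomologicalComplex _).map ((NatTrans.mapHomologicalComplex α _).app K) ≫
        comparisonHom e' φ =
      comparisonHom e φ ≫ (NatTrans.mapHomologicalComplex β _).app L := by
  ext n : 1
  have h := β.naturality (φ.f n)
  change (scalars R).map (α.app (K.X n)) ≫ e'.hom.app (K.X n) ≫ G'.map (φ.f n) =
    (e.hom.app (K.X n) ≫ G.map (φ.f n)) ≫ β.app (L.X n)
  rw [reassoc_of% w, Category.assoc]
  exact congrArg (e.hom.app (K.X n) ≫ ·) h.symm

/-- The comparison of derived functors defined by `comparisonHom`, for an injective resolution `P`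
of an `S`-module `N` and an injective resolution `Q` of the underlying `R`-module. -/
noncomputable def comparison (e : F ⋙ scalars R ≅ scalars R ⋙ G) {N : ModuleCat.{u} S}
    (P : InjectiveResolution N) (Q : InjectiveResolution ((scalars R).obj N))
    (φ : scalarsComplex R P.cocomplex ⟶ Q.cocomplex) (i : ℕ) :
    (scalars R).obj ((F.rightDerived i).obj N) ⟶ (G.rightDerived i).obj ((scalars R).obj N) :=
  (scalars R).map (P.isoRightDerivedObj F i).hom ≫ (scalarsHomologyIso R _ i).hom ≫
    (HomologicalComplex.homologyFunctor _ _ i).map (comparisonHom e φ) ≫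
      (Q.isoRightDerivedObj G i).inv

theorem comparison_naturality (e : F ⋙ scalars R ≅ scalars R ⋙ G)
    (e' : F' ⋙ scalars R ≅ scalars R ⋙ G') (α : F ⟶ F') (β : G ⟶ G')
    (w : ∀ M, (scalars R).map (α.app M) ≫ e'.hom.app M = e.hom.app M ≫ β.app ((scalars R).obj M))
    {N : ModuleCat.{u} S}
    (P : InjectiveResolution N) (Q : InjectiveResolution ((scalars R).obj N))
    (φ : scalarsComplex R P.cocomplex ⟶ Q.cocomplex) (i : ℕ) :
    (scalars R).map ((NatTrans.rightDerived α i).app N) ≫ comparison e' P Q φ i =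
      comparison e P Q φ i ≫ (NatTrans.rightDerived β i).app ((scalars R).obj N) := by
  rw [InjectiveResolution.rightDerived_app_eq α P, InjectiveResolution.rightDerived_app_eq β Q]
  have h0 : (scalars R).map (P.isoRightDerivedObj F' i).inv ≫
      (scalars R).map (P.isoRightDerivedObj F' i).hom = 𝟙 _ :=
    ((scalars R).mapIso (P.isoRightDerivedObj F' i)).inv_hom_id
  have h1 := scalarsHomologyIso_hom_naturality R
    ((NatTrans.mapHomologicalComplex α (ComplexShape.up ℕ)).app P.cocomplex) i
  have h2 := congrArg (HomologicalComplex.homologyFunctor _ _ i).map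
    (comparisonHom_naturality e e' α β w φ)
  rw [Functor.map_comp, Functor.map_comp] at h2
  simp only [comparison, Functor.map_comp, Category.assoc, Iso.inv_hom_id_assoc]
  rw [reassoc_of% h0, reassoc_of% h1, reassoc_of% h2]

/-- The comparison of derived functors is an isomorphism when `G` can be computed by flabby
resolutions: the `R`-modules underlying an injective resolution over `S` are flabby. -/
theorem isIso_comparison [IsNoetherianRing R] [IsNoetherianRing S]
    (hG : PreservesFlabbyQuasiIso G) (e : F ⋙ scalars R ≅ scalars R ⋙ G) {N : ModuleCat.{u} S}
    (P : InjectiveResolution N) (Q : InjectiveResolution ((scalars R).obj N))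
    (φ : scalarsComplex R P.cocomplex ⟶ Q.cocomplex)
    (hφ : (scalars R).map (augmentation P) ≫ φ.f 0 = augmentation Q) (i : ℕ) :
    IsIso (comparison e P Q φ i) := by
  have h1 : QuasiIso φ := (isResolution_scalars R (isResolution_of_injectiveResolution P)).quasiIso
    (isResolution_of_injectiveResolution Q) φ hφ
  have h2 : QuasiIso ((G.mapHomologicalComplex (ComplexShape.up ℕ)).map φ) := by
    refine hG φ (fun n => ?_) (fun n => ?_) h1
    · have := P.injective n
      exact isFlabby_scalars R _ (isFlabby_of_injective (P.cocomplex.X n))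
    · have := Q.injective n
      exact isFlabby_of_injective _
  have h3 : QuasiIso (comparisonHom e φ) := quasiIso_comp _ _
  have h4 : IsIso ((HomologicalComplex.homologyFunctor _ _ i).map (comparisonHom e φ)) :=
    (quasiIsoAt_iff_isIso_homologyMap _ i).mp (h3.quasiIsoAt i)
  unfold comparison
  infer_instance

end Comparison

/-! ### Sections with support and restriction of scalars -/

section SectionsComparison

variable {R : Type u} (S : Type u) [CommRing R] [CommRing S] [Algebra R S]

/-- The identity map `ρ (Γ_Z(M)) → Γ_Z(ρ M)`, for `ρ` the restriction of scalars. -/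
noncomputable def sectionsComparisonHom (Z : Closeds (PrimeSpectrum R)) (M : ModuleCat.{u} S) :
    (scalars R).obj ((sectionsFunctor (preimage S Z)).obj M) ⟶
      (sectionsFunctor Z).obj ((scalars R).obj M) :=
  ConcreteCategory.ofHom (C := ModuleCat R)
    { toFun x := ⟨x.1, (mem_sections_scalars_iff R Z M x.1).mp x.2⟩
      map_add' _ _ := rfl
      map_smul' _ _ := rfl }

instance (Z : Closeds (PrimeSpectrum R)) (M : ModuleCat.{u} S) :
    IsIso (sectionsComparisonHom S Z M) :=
  (ConcreteCategory.isIso_iff_bijective _).mpr ⟨fun x y h =>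
    (Subtype.ext (congrArg Subtype.val h : x.1 = y.1) : (x : sections (preimage S Z) M) = y),
    fun x => ⟨⟨x.1, (mem_sections_scalars_iff R Z M x.1).mpr x.2⟩, rfl⟩⟩

/-- `Γ_Z` commutes with restriction of scalars. -/
noncomputable def sectionsComparison (Z : Closeds (PrimeSpectrum R)) :
    sectionsFunctor (preimage S Z) ⋙ scalars R ≅ scalars R ⋙ sectionsFunctor Z :=
  NatIso.ofComponents (fun M => asIso (sectionsComparisonHom S Z M)) fun _ => rfl

/-- The identity map `ρ (Γ_{Z₁/Z₂}(M)) → Γ_{Z₁/Z₂}(ρ M)`, for `ρ` the restriction of scalars. -/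
noncomputable def relSectionsComparisonHom (Z₁ Z₂ : Closeds (PrimeSpectrum R))
    (M : ModuleCat.{u} S) :
    (scalars R).obj ((relSectionsFunctor (preimage S Z₁) (preimage S Z₂)).obj M) ⟶
      (relSectionsFunctor Z₁ Z₂).obj ((scalars R).obj M) :=
  ConcreteCategory.ofHom (C := ModuleCat R)
    { toFun := QuotientAddGroup.map
        ((sections (preimage S Z₁) M).submoduleOf (sections (preimage S Z₂) M)).toAddSubgroup
        ((sections Z₁ ((scalars R).obj M)).submoduleOf
          (sections Z₂ ((scalars R).obj M))).toAddSubgroup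
        (sectionsComparisonHom S Z₂ M).hom.toAddMonoidHom
        fun x hx => (mem_sections_scalars_iff R Z₁ M x.1).mp hx
      map_add' := map_add _
      map_smul' r x := by
        obtain ⟨x, rfl⟩ := Submodule.Quotient.mk_surjective _ x
        rfl }

instance (Z₁ Z₂ : Closeds (PrimeSpectrum R)) (M : ModuleCat.{u} S) :
    IsIso (relSectionsComparisonHom S Z₁ Z₂ M) := by
  refine (ConcreteCategory.isIso_iff_bijective _).mpr ⟨?_, fun x => ?_⟩
  · refine (injective_iff_map_eq_zero (relSectionsComparisonHom S Z₁ Z₂ M).hom).mpr fun x hx => ?_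
    obtain ⟨x, rfl⟩ := Submodule.Quotient.mk_surjective
      ((sections (preimage S Z₁) M).submoduleOf (sections (preimage S Z₂) M)) x
    have h := (Submodule.Quotient.mk_eq_zero
      ((sections Z₁ ((scalars R).obj M)).submoduleOf (sections Z₂ ((scalars R).obj M)))
        (x := sectionsComparisonHom S Z₂ M x)).mp hx
    exact (Submodule.Quotient.mk_eq_zero
      ((sections (preimage S Z₁) M).submoduleOf (sections (preimage S Z₂) M))).mpr
        ((mem_sections_scalars_iff R Z₁ M x.1).mpr h)
  · obtain ⟨x, rfl⟩ := Submodule.Quotient.mk_surjective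
      ((sections Z₁ ((scalars R).obj M)).submoduleOf (sections Z₂ ((scalars R).obj M))) x
    exact ⟨Submodule.Quotient.mk
      (p := (sections (preimage S Z₁) M).submoduleOf (sections (preimage S Z₂) M))
      ⟨x.1, (mem_sections_scalars_iff R Z₂ M x.1).mpr x.2⟩, rfl⟩

/-- `Γ_{Z₁/Z₂}` commutes with restriction of scalars. -/
noncomputable def relSectionsComparison (Z₁ Z₂ : Closeds (PrimeSpectrum R)) :
    relSectionsFunctor (preimage S Z₁) (preimage S Z₂) ⋙ scalars R ≅
      scalars R ⋙ relSectionsFunctor Z₁ Z₂ :=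
  NatIso.ofComponents (fun M => asIso (relSectionsComparisonHom S Z₁ Z₂ M)) fun {M N} f => by
    ext x
    obtain ⟨x, rfl⟩ := Submodule.Quotient.mk_surjective
      ((sections (preimage S Z₁) M).submoduleOf (sections (preimage S Z₂) M)) x
    rfl

theorem sectionsComparison_incl {Z₁ Z₂ : Closeds (PrimeSpectrum R)} (h : Z₁ ≤ Z₂)
    (M : ModuleCat.{u} S) :
    (scalars R).map ((sectionsIncl (preimage_mono S h)).app M) ≫
        (sectionsComparison S Z₂).hom.app M =
      (sectionsComparison S Z₁).hom.app M ≫ (sectionsIncl h).app ((scalars R).obj M) :=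
  rfl

theorem sectionsComparison_proj (Z₁ Z₂ : Closeds (PrimeSpectrum R)) (M : ModuleCat.{u} S) :
    (scalars R).map ((sectionsProj (preimage S Z₁) (preimage S Z₂)).app M) ≫
        (relSectionsComparison S Z₁ Z₂).hom.app M =
      (sectionsComparison S Z₂).hom.app M ≫ (sectionsProj Z₁ Z₂).app ((scalars R).obj M) :=
  rfl

end SectionsComparison

end Lyubeznik

namespace Lyubeznik

open TopologicalSpace

/-! ### Exact functors and exact sequences in abelian categories -/

section Abelian

variable {C : Type*} [Category* C] [Abelian C]

theorem nonempty_image_iso_kernel_of_exact {X Y Z : C} {f : X ⟶ Y} {g : Y ⟶ Z} {w : f ≫ g = 0}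
    (h : (ShortComplex.mk f g w).Exact) : Nonempty (Abelian.image f ≅ kernel g) :=
  ⟨Abelian.imageIsoImage f ≪≫ (imageSubobjectIso f).symm ≪≫
    Subobject.isoOfEq _ _ ((ShortComplex.exact_iff_image_eq_kernel _).mp h) ≪≫
    kernelSubobjectIso g⟩

theorem nonempty_cokernel_iso_image_of_exact {X Y Z : C} {f : X ⟶ Y} {g : Y ⟶ Z} {w : f ≫ g = 0}
    (h : (ShortComplex.mk f g w).Exact) : Nonempty (cokernel f ≅ Abelian.image g) := by
  have : Epi (kernel.lift g f w) := (ShortComplex.exact_iff_epi_kernel_lift _).mp h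
  exact ⟨(cokernelIsoOfEq (kernel.lift_ι g f w)).symm ≪≫
    cokernelEpiComp (kernel.lift g f w) (kernel.ι g) ≪≫ Abelian.coimageIsoImage g⟩

/-- Kernels of natural transformations are computed objectwise. -/
noncomputable def kernelApp {B : Type*} [Category* B] {F G : B ⥤ C} (α : F ⟶ G) (X : B) :
    (kernel α).obj X ≅ kernel (α.app X) :=
  PreservesKernel.iso ((evaluation B C).obj X) α

/-- Cokernels of natural transformations are computed objectwise. -/
noncomputable def cokernelApp {B : Type*} [Category* B] {F G : B ⥤ C} (α : F ⟶ G) (X : B) :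
    (cokernel α).obj X ≅ cokernel (α.app X) :=
  PreservesCokernel.iso ((evaluation B C).obj X) α

/-- Images of natural transformations are computed objectwise. -/
noncomputable def imageApp {B : Type*} [Category* B] {F G : B ⥤ C} (α : F ⟶ G) (X : B) :
    (image α).obj X ≅ Abelian.image (α.app X) :=
  (Abelian.imageIsoImage α).symm.app X ≪≫
    Abelian.PreservesImage.iso ((evaluation B C).obj X) α

variable {D : Type*} [Category* D] [Abelian D] (ρ : C ⥤ D) [ρ.Additive]

theorem nonempty_map_kernel_iso [PreservesFiniteLimits ρ]
    {X Y : C} {X' Y' : D} (f : X ⟶ Y) (g : X' ⟶ Y')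
    (a : ρ.obj X ≅ X') (b : ρ.obj Y ≅ Y') (w : ρ.map f ≫ b.hom = a.hom ≫ g) :
    Nonempty (ρ.obj (kernel f) ≅ kernel g) :=
  ⟨PreservesKernel.iso ρ f ≪≫ kernel.mapIso _ _ a b w⟩

theorem nonempty_map_cokernel_iso [PreservesFiniteColimits ρ]
    {X Y : C} {X' Y' : D} (f : X ⟶ Y) (g : X' ⟶ Y')
    (a : ρ.obj X ≅ X') (b : ρ.obj Y ≅ Y') (w : ρ.map f ≫ b.hom = a.hom ≫ g) :
    Nonempty (ρ.obj (cokernel f) ≅ cokernel g) :=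
  ⟨PreservesCokernel.iso ρ f ≪≫ cokernel.mapIso _ _ a b w⟩

theorem nonempty_map_image_iso [PreservesFiniteLimits ρ] [PreservesFiniteColimits ρ]
    {X Y : C} {X' Y' : D} (f : X ⟶ Y) (g : X' ⟶ Y')
    (a : ρ.obj X ≅ X') (b : ρ.obj Y ≅ Y') (w : ρ.map f ≫ b.hom = a.hom ≫ g) :
    Nonempty (ρ.obj (Abelian.image f) ≅ Abelian.image g) :=
  ⟨Abelian.PreservesImage.iso ρ f ≪≫ kernel.mapIso _ _ b (cokernel.mapIso _ _ a b w)
    (by simp)⟩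

end Abelian

/-! ### Elimination of the connecting map -/

section LongExactSequence

theorem exact_of_conj {C : Type*} [Category* C] [Abelian C] {X Y Z X' Y' Z' : C} {f : X ⟶ Y}
    {g : Y ⟶ Z} {w : f ≫ g = 0} (h : (ShortComplex.mk f g w).Exact) (a : X' ≅ X) (b : Y' ≅ Y)
    (c : Z' ≅ Z) {f' : X' ⟶ Y'} {g' : Y' ⟶ Z'} (hf : f' = a.hom ≫ f ≫ b.inv)
    (hg : g' = b.hom ≫ g ≫ c.inv) : ∃ w', (ShortComplex.mk f' g' w').Exact := by
  subst hf hg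
  exact ⟨by simp [reassoc_of% w], ShortComplex.exact_of_iso
    (ShortComplex.isoMk a.symm b.symm c.symm (by simp) (by simp)) h⟩

variable {R : Type u} [CommRing R] {Z₁ Z₂ : Closeds (PrimeSpectrum R)} (h : Z₁ ≤ Z₂) (i : ℕ)
  (M : ModuleCat.{u} R)

theorem rightDerived_sectionsProj_app : (NatTrans.rightDerived (sectionsProj Z₁ Z₂) i).app M =
      ((injectiveResolution M).isoRightDerivedObj (sectionsFunctor Z₂) i).hom ≫
        (HomologicalComplex.homologyFunctor _ _ i).map
          (sectionsShortComplex h (injectiveResolution M).cocomplex).g ≫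
        ((injectiveResolution M).isoRightDerivedObj (relSectionsFunctor Z₁ Z₂) i).inv :=
  InjectiveResolution.rightDerived_app_eq (sectionsProj Z₁ Z₂) (injectiveResolution M) i

theorem rightDerived_sectionsIncl_app : (NatTrans.rightDerived (sectionsIncl h) i).app M =
      ((injectiveResolution M).isoRightDerivedObj (sectionsFunctor Z₁) i).hom ≫
        (HomologicalComplex.homologyFunctor _ _ i).map
          (sectionsShortComplex h (injectiveResolution M).cocomplex).f ≫
        ((injectiveResolution M).isoRightDerivedObj (sectionsFunctor Z₂) i).inv :=
  InjectiveResolution.rightDerived_app_eq (sectionsIncl h) (injectiveResolution M) i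

theorem exact_proj_connecting : ∃ w, (ShortComplex.mk
    ((NatTrans.rightDerived (sectionsProj Z₁ Z₂) i).app M) ((connecting h i).app M) w).Exact :=
  exact_of_conj
    ((sectionsShortComplex_shortExact h (injectiveResolution M).cocomplex).homology_exact₃ i (i + 1)
      (by simp)) _ _ _ (rightDerived_sectionsProj_app h i M) rfl

theorem exact_connecting_incl : ∃ w, (ShortComplex.mk ((connecting h i).app M)
    ((NatTrans.rightDerived (sectionsIncl h) (i + 1)).app M) w).Exact :=
  exact_of_conj
    ((sectionsShortComplex_shortExact h (injectiveResolution M).cocomplex).homology_exact₁ i (i + 1)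
      (by simp)) _ _ _ rfl (rightDerived_sectionsIncl_app h (i + 1) M)

/-- By exactness of the long exact sequence, the kernel of the connecting map is isomorphic to the
image of the preceding map. -/
theorem nonempty_kernel_connecting_iso : Nonempty ((kernel (connecting h i)).obj M ≅
    Abelian.image ((NatTrans.rightDerived (sectionsProj Z₁ Z₂) i).app M)) := by
  obtain ⟨w, hw⟩ := exact_proj_connecting h i M
  obtain ⟨e⟩ := nonempty_image_iso_kernel_of_exact hw
  exact ⟨kernelApp (connecting h i) M ≪≫ e.symm⟩

theorem nonempty_image_connecting_iso : Nonempty ((image (connecting h i)).obj M ≅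
    kernel ((NatTrans.rightDerived (sectionsIncl h) (i + 1)).app M)) := by
  obtain ⟨w, hw⟩ := exact_connecting_incl h i M
  obtain ⟨e⟩ := nonempty_image_iso_kernel_of_exact hw
  exact ⟨imageApp (connecting h i) M ≪≫ e⟩

theorem nonempty_cokernel_connecting_iso : Nonempty ((cokernel (connecting h i)).obj M ≅
    Abelian.image ((NatTrans.rightDerived (sectionsIncl h) (i + 1)).app M)) := by
  obtain ⟨w, hw⟩ := exact_connecting_incl h i M
  obtain ⟨e⟩ := nonempty_cokernel_iso_image_of_exact hw
  exact ⟨cokernelApp (connecting h i) M ≪≫ e⟩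

end LongExactSequence

end Lyubeznik

namespace Lyubeznik

open TopologicalSpace

/-! ### Lyubeznik functors commute with restriction of scalars -/

section BaseChange

variable (R : Type u) {S : Type u} [CommRing R] [CommRing S] [Algebra R S] [IsNoetherianRing R]
  [IsNoetherianRing S]

/-- Local cohomology commutes with restriction of scalars, compatibly with the maps
`H^i_{Z₁} → H^i_{Z₂} → H^i_{Z₁/Z₂}`. -/
theorem exists_cohomology_comparison (N : ModuleCat.{u} S) :
    ∃ (c : ∀ (Z : Closeds (PrimeSpectrum R)) (i : ℕ),
        (scalars R).obj ((cohomology (preimage S Z) i).obj N) ≅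
          (cohomology Z i).obj ((scalars R).obj N))
      (r : ∀ (Z₁ Z₂ : Closeds (PrimeSpectrum R)) (_ : Z₁ ≤ Z₂) (i : ℕ),
        (scalars R).obj ((relCohomology (preimage S Z₁) (preimage S Z₂) i).obj N) ≅
          (relCohomology Z₁ Z₂ i).obj ((scalars R).obj N)),
      (∀ (Z₁ Z₂ : Closeds (PrimeSpectrum R)) (h : Z₁ ≤ Z₂) (i : ℕ),
        (scalars R).map ((NatTrans.rightDerived (sectionsIncl (preimage_mono S h)) i).app N) ≫
          (c Z₂ i).hom = (c Z₁ i).hom ≫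
            (NatTrans.rightDerived (sectionsIncl h) i).app ((scalars R).obj N)) ∧
      ∀ (Z₁ Z₂ : Closeds (PrimeSpectrum R)) (h : Z₁ ≤ Z₂) (i : ℕ),
        (scalars R).map ((NatTrans.rightDerived
            (sectionsProj (preimage S Z₁) (preimage S Z₂)) i).app N) ≫ (r Z₁ Z₂ h i).hom =
          (c Z₂ i).hom ≫
            (NatTrans.rightDerived (sectionsProj Z₁ Z₂) i).app ((scalars R).obj N) := by
  let P := injectiveResolution N
  let Q := injectiveResolution ((scalars R).obj N)
  obtain ⟨φ, hφ⟩ :=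
    (isResolution_scalars R (isResolution_of_injectiveResolution P)).exists_hom Q
  have hc : ∀ (Z : Closeds (PrimeSpectrum R)) (i : ℕ),
      IsIso (comparison (sectionsComparison S Z) P Q φ i) := fun Z i =>
    isIso_comparison (fun _ _ φ hK hL hφ => quasiIso_map_sectionsFunctor φ hK hL hφ Z) _ P Q φ hφ i
  have hr : ∀ (Z₁ Z₂ : Closeds (PrimeSpectrum R)) (_ : Z₁ ≤ Z₂) (i : ℕ),
      IsIso (comparison (relSectionsComparison S Z₁ Z₂) P Q φ i) := fun Z₁ Z₂ h i =>
    isIso_comparison (fun _ _ φ hK hL hφ => quasiIso_map_relSectionsFunctor φ hK hL hφ h)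
      _ P Q φ hφ i
  refine ⟨fun Z i => @asIso _ _ _ _ _ (hc Z i), fun Z₁ Z₂ h i => @asIso _ _ _ _ _ (hr Z₁ Z₂ h i),
    fun Z₁ Z₂ h i => ?_, fun Z₁ Z₂ h i => ?_⟩
  · exact comparison_naturality _ _ _ _ (sectionsComparison_incl S h) P Q φ i
  · exact comparison_naturality _ _ _ _ (sectionsComparison_proj S Z₁ Z₂) P Q φ i

/-- Restriction of scalars carries a factor over `S` to the factor over `R` it comes from. -/
theorem nonempty_scalars_factor_iso (F : Factor R) (N : ModuleCat.{u} S) :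
    Nonempty ((scalars R).obj ((F.baseChange S).functor.obj N) ≅
      F.functor.obj ((scalars R).obj N)) := by
  obtain ⟨c, r, hincl, hproj⟩ := exists_cohomology_comparison R N
  cases F with
  | coh Z i => exact ⟨c Z i⟩
  | ker Z₁ Z₂ h k i =>
    cases k with
    | incl =>
      obtain ⟨e⟩ := nonempty_map_kernel_iso (scalars R) _ _ _ _ (hincl Z₁ Z₂ h i)
      exact ⟨(scalars R).mapIso (kernelApp _ N) ≪≫ e ≪≫ (kernelApp _ _).symm⟩
    | proj =>
      obtain ⟨e⟩ := nonempty_map_kernel_iso (scalars R) _ _ _ _ (hproj Z₁ Z₂ h i)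
      exact ⟨(scalars R).mapIso (kernelApp _ N) ≪≫ e ≪≫ (kernelApp _ _).symm⟩
    | conn =>
      obtain ⟨e⟩ := nonempty_map_image_iso (scalars R) _ _ _ _ (hproj Z₁ Z₂ h i)
      obtain ⟨e₁⟩ := nonempty_kernel_connecting_iso h i ((scalars R).obj N)
      obtain ⟨e₂⟩ := nonempty_kernel_connecting_iso (preimage_mono S h) i N
      exact ⟨(scalars R).mapIso e₂ ≪≫ e ≪≫ e₁.symm⟩
  | im Z₁ Z₂ h k i =>
    cases k with
    | incl =>
      obtain ⟨e⟩ := nonempty_map_image_iso (scalars R) _ _ _ _ (hincl Z₁ Z₂ h i)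
      exact ⟨(scalars R).mapIso (imageApp _ N) ≪≫ e ≪≫ (imageApp _ _).symm⟩
    | proj =>
      obtain ⟨e⟩ := nonempty_map_image_iso (scalars R) _ _ _ _ (hproj Z₁ Z₂ h i)
      exact ⟨(scalars R).mapIso (imageApp _ N) ≪≫ e ≪≫ (imageApp _ _).symm⟩
    | conn =>
      obtain ⟨e⟩ := nonempty_map_kernel_iso (scalars R) _ _ _ _ (hincl Z₁ Z₂ h (i + 1))
      obtain ⟨e₁⟩ := nonempty_image_connecting_iso h i ((scalars R).obj N)
      obtain ⟨e₂⟩ := nonempty_image_connecting_iso (preimage_mono S h) i N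
      exact ⟨(scalars R).mapIso e₂ ≪≫ e ≪≫ e₁.symm⟩
  | coker Z₁ Z₂ h k i =>
    cases k with
    | incl =>
      obtain ⟨e⟩ := nonempty_map_cokernel_iso (scalars R) _ _ _ _ (hincl Z₁ Z₂ h i)
      exact ⟨(scalars R).mapIso (cokernelApp _ N) ≪≫ e ≪≫ (cokernelApp _ _).symm⟩
    | proj =>
      obtain ⟨e⟩ := nonempty_map_cokernel_iso (scalars R) _ _ _ _ (hproj Z₁ Z₂ h i)
      exact ⟨(scalars R).mapIso (cokernelApp _ N) ≪≫ e ≪≫ (cokernelApp _ _).symm⟩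
    | conn =>
      obtain ⟨e⟩ := nonempty_map_image_iso (scalars R) _ _ _ _ (hincl Z₁ Z₂ h (i + 1))
      obtain ⟨e₁⟩ := nonempty_cokernel_connecting_iso h i ((scalars R).obj N)
      obtain ⟨e₂⟩ := nonempty_cokernel_connecting_iso (preimage_mono S h) i N
      exact ⟨(scalars R).mapIso e₂ ≪≫ e ≪≫ e₁.symm⟩

/-- Lyubeznik functors commute with restriction of scalars. -/
theorem nonempty_scalars_lyubeznikFunctor_iso (T : List (Factor R)) (N : ModuleCat.{u} S) :
    Nonempty ((scalars R).obj ((lyubeznikFunctor (T.map (Factor.baseChange S))).obj N) ≅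
      (lyubeznikFunctor T).obj ((scalars R).obj N)) := by
  induction T with
  | nil => exact ⟨Iso.refl _⟩
  | cons F T ih =>
    obtain ⟨e⟩ := ih
    obtain ⟨e'⟩ := nonempty_scalars_factor_iso R F
      ((lyubeznikFunctor (T.map (Factor.baseChange S))).obj N)
    exact ⟨e' ≪≫ F.functor.mapIso e⟩

end BaseChange

end Lyubeznik

namespace Lyubeznik

open TopologicalSpace

/-! ### Pure extensions as colimits of split extensions -/

section Purity

variable {R S : Type u} [CommRing R] [CommRing S] [Algebra R S]

/-- A finite system of linear equations `Σ_j h_ij x_j = 0`, `Σ_j c_j x_j = 1` with coefficients in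
`R` that is solvable in a pure extension is solvable in `R`: otherwise the class of `(0, 1)` in the
cokernel of the system would be killed by the extension. -/
theorem IsPureExtension.exists_solution (hpure : IsPureExtension R S) {m n : ℕ}
    (h : Fin m → Fin n → R) (c : Fin n → R) (g : Fin n → S) (hg : ∀ i, ∑ j, h i j • g j = 0)
    (hc : ∑ j, c j • g j = 1) :
    ∃ x : Fin n → R, (∀ i, ∑ j, h i j * x j = 0) ∧ ∑ j, c j * x j = 1 := by
  let A : (Fin n → R) →ₗ[R] (Fin m → R) × R :=
    { toFun x := (fun i => ∑ j, h i j * x j, ∑ j, c j * x j)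
      map_add' x y := by
        ext <;> simp [mul_add, Finset.sum_add_distrib]
      map_smul' r x := by
        ext <;> simp [Finset.mul_sum, mul_left_comm] }
  let q := A.range.mkQ
  suffices hq : q (0, 1) = 0 by
    obtain ⟨x, hx⟩ := (Submodule.Quotient.mk_eq_zero _).mp hq
    exact ⟨x, fun i => congrFun (congrArg Prod.fst hx) i, congrArg Prod.snd hx⟩
  apply hpure (((Fin m → R) × R) ⧸ A.range)
  change q (0, 1) ⊗ₜ[R] (1 : S) = 0 ⊗ₜ[R] 1
  have hA : ∀ j, A (Pi.single j 1) = ∑ i, h i j • (Pi.single i 1, 0) + c j • (0, 1) := by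
    intro j
    ext i
    · simp [A, Prod.fst_sum, Finset.sum_apply, Pi.single_apply]
    · simp [A, Prod.snd_sum, Pi.single_apply]
  have h0 : ∀ j, q (A (Pi.single j 1)) = 0 := fun j =>
    (Submodule.Quotient.mk_eq_zero _).mpr ⟨_, rfl⟩
  -- over `S` the class `q (0, 1)` is the combination, with coefficients `g j`, of the relations
  have h1 : ∑ j, q (A (Pi.single j 1)) ⊗ₜ[R] g j = q (0, 1) ⊗ₜ[R] (1 : S) := by
    simp only [hA, map_add, map_sum, map_smul, TensorProduct.add_tmul, TensorProduct.sum_tmul,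
      TensorProduct.smul_tmul, Finset.sum_add_distrib]
    rw [Finset.sum_comm]
    simp only [← TensorProduct.tmul_sum, hg, hc, TensorProduct.tmul_zero, Finset.sum_const_zero,
      zero_add]
  rw [← h1, TensorProduct.zero_tmul]
  simp [h0]

/-- If `R → S` is pure and `R` is Noetherian, then `R` is a direct summand of every finitely
generated `R`-submodule of `S` containing `1`. -/
theorem IsPureExtension.exists_retraction [IsNoetherianRing R] (hpure : IsPureExtension R S)
    (N : Submodule R S) (hN : N.FG) (h1 : 1 ∈ N) : ∃ π : N →ₗ[R] R, π ⟨1, h1⟩ = 1 := by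
  have := Module.Finite.of_fg hN
  obtain ⟨n, f, hf⟩ := Module.Finite.exists_fin' R N
  obtain ⟨m, k, hk⟩ := Module.Finite.exists_fin' R f.ker
  obtain ⟨c, hc⟩ := hf ⟨1, h1⟩
  have hsum : ∀ x : Fin n → R, ∑ j, x j • (f (Pi.single j 1) : S) = f x := by
    intro x
    conv_rhs => rw [pi_eq_sum_univ' x]
    rw [map_sum, AddSubmonoidClass.coe_finsetSum]
    exact Finset.sum_congr rfl fun j _ => by rw [map_smul]; rfl
  obtain ⟨x, hx, hx'⟩ := hpure.exists_solution (fun i => (k (Pi.single i 1)).1) c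
    (fun j => f (Pi.single j 1)) (fun i => by rw [hsum, (k (Pi.single i 1)).2]; rfl)
    (by rw [hsum, hc])
  let l : (Fin n → R) →ₗ[R] R := Fintype.linearCombination R x
  have hl : f.ker ≤ l.ker := by
    intro y hy
    obtain ⟨z, hz⟩ := hk ⟨y, hy⟩
    have : l ∘ₗ f.ker.subtype ∘ₗ k = 0 := by
      ext i
      simpa [l, Fintype.linearCombination_apply] using hx i
    have h := LinearMap.congr_fun this z
    simpa [hz] using h
  refine ⟨f.ker.liftQ l hl ∘ₗ (f.quotKerEquivOfSurjective hf).symm.toLinearMap, ?_⟩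
  rw [← hc]
  have : (f.quotKerEquivOfSurjective hf).symm (f c) = Submodule.Quotient.mk c := by
    rw [LinearEquiv.symm_apply_eq]; rfl
  rw [LinearMap.comp_apply, LinearEquiv.coe_coe, this, Submodule.liftQ_apply]
  simpa [l, Fintype.linearCombination_apply] using hx'

variable (R S)

/-- The directed set of finitely generated `R`-submodules of `S` containing `1`. -/
abbrev FGSubmodule := {N : Submodule R S // N.FG ∧ 1 ∈ N}

instance : IsDirected (FGSubmodule R S) (· ≤ ·) where
  directed N N' := ⟨⟨N.1 ⊔ N'.1, N.2.1.sup N'.2.1, Submodule.mem_sup_left N.2.2⟩,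
    le_sup_left (a := N.1), le_sup_right (a := N.1)⟩

instance : Nonempty (FGSubmodule R S) :=
  ⟨⟨R ∙ 1, Submodule.fg_span_singleton 1, Submodule.mem_span_singleton_self 1⟩⟩

/-- The diagram of the finitely generated `R`-submodules of `S` containing `1`. -/
def fgDiagram : FGSubmodule R S ⥤ ModuleCat.{u} R where
  obj N := ModuleCat.of R N.1
  map f := ModuleCat.ofHom (Submodule.inclusion (leOfHom f))

/-- `S` is a cocone over the diagram of its finitely generated `R`-submodules containing `1`. -/
def fgCocone : Cocone (fgDiagram R S) where
  pt := ModuleCat.of R S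
  ι := { app N := ModuleCat.ofHom N.1.subtype }

theorem nonempty_isColimit_fgCocone : Nonempty (IsColimit (fgCocone R S)) := by
  rw [nonempty_isColimit_iff]
  refine ⟨fun x => ?_, fun N y hy => ⟨N, 𝟙 N, ?_⟩⟩
  · let s : S := x
    exact ⟨⟨Submodule.span R {1, s}, Submodule.fg_span (by simp),
      Submodule.subset_span (by simp)⟩, ⟨s, Submodule.subset_span (by simp)⟩, rfl⟩
  · exact Subtype.ext hy

variable {R S}

/-- A functor preserving filtered colimits turns a pure extension of a Noetherian ring into an
injective map. -/
theorem IsPureExtension.injective_map [IsNoetherianRing R] (hpure : IsPureExtension R S)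
    (T : ModuleCat.{u} R ⥤ ModuleCat.{u} R) [PreservesColimitsOfShape (FGSubmodule R S) T] :
    Function.Injective
      (T.map (ModuleCat.ofHom (Algebra.linearMap R S) : ModuleCat.of R R ⟶ ModuleCat.of R S)) := by
  obtain ⟨hcolim⟩ := nonempty_isColimit_fgCocone R S
  obtain ⟨N₀⟩ := (inferInstance : Nonempty (FGSubmodule R S))
  let u : ModuleCat.of R R ⟶ (fgDiagram R S).obj N₀ :=
    ModuleCat.ofHom (LinearMap.toSpanSingleton R N₀.1 ⟨1, N₀.2.2⟩)
  have hu : u ≫ (fgCocone R S).ι.app N₀ = ModuleCat.ofHom (Algebra.linearMap R S) := by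
    ext
    exact (one_smul R (1 : S)).trans (map_one (algebraMap R S)).symm
  refine (injective_iff_map_eq_zero (T.map (ModuleCat.ofHom (Algebra.linearMap R S))).hom).mpr
    fun x hx => ?_
  have hx' : T.map ((fgCocone R S).ι.app N₀) (T.map u x) = 0 := by
    refine (ConcreteCategory.congr_hom (T.map_comp _ _) x).symm.trans ?_
    rw [hu]
    exact hx
  obtain ⟨N, f, hf⟩ := ((preservesColimitsOfShape_iff T).mp inferInstance _ _ hcolim).2 N₀ _ hx'
  obtain ⟨π, hπ⟩ := hpure.exists_retraction N.1 N.2.1 N.2.2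
  let p : (fgDiagram R S).obj N ⟶ ModuleCat.of R R := ModuleCat.ofHom π
  have hid : u ≫ (fgDiagram R S).map f ≫ p = 𝟙 (ModuleCat.of R R) := by
    ext
    refine Eq.trans (congrArg π (Subtype.ext ?_)) hπ
    exact one_smul R (1 : S)
  have h1 := ConcreteCategory.congr_hom (congrArg T.map hid) x
  rw [T.map_id, T.map_comp, T.map_comp] at h1
  refine (h1.symm.trans ((congrArg (T.map p) hf).trans ?_))
  exact map_zero (T.map p).hom

end Purity

/-! ### Associated primes and restriction of scalars -/

section AssociatedPrimes

variable (R : Type u) {S : Type u} [CommRing R] [CommRing S] [Algebra R S]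

/-- Over `R`, the associated primes of a module over a Noetherian `R`-algebra `S` are contractions
of its associated primes over `S`. -/
theorem associatedPrimes_scalars_subset [IsNoetherianRing S] (M : ModuleCat.{u} S) :
    associatedPrimes R ((scalars R).obj M) ⊆
      Ideal.comap (algebraMap R S) '' associatedPrimes S M := by
  rintro p ⟨hp, x, hx⟩
  have hann : (⊥ : Submodule R ((scalars R).obj M)).colon {x} =
      ((⊥ : Submodule S M).colon {(show M from x)}).comap (algebraMap R S) := by
    ext r
    rw [Ideal.mem_comap, Submodule.mem_colon_singleton, Submodule.mem_colon_singleton]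
    rfl
  have hmin : p ∈ (((⊥ : Submodule S M).colon {(show M from x)}).comap
      (algebraMap R S)).minimalPrimes := by
    rw [← hann, ← Ideal.radical_minimalPrimes, ← hx, Ideal.minimalPrimes_eq_subsingleton_self]
    rfl
  obtain ⟨q, hq, rfl⟩ := Ideal.exists_minimalPrimes_comap_eq _ _ hmin
  exact ⟨q, isAssociatedPrime_iff.mpr
    ⟨hq.isPrime, Submodule.exists_eq_colon_of_mem_minimalPrimes hq⟩, rfl⟩

end AssociatedPrimes

/-! ### Finiteness of associated primes -/

section Finiteness

variable {R S : Type u} [CommRing R] [CommRing S] [Algebra R S] [IsNoetherianRing R]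
  [IsNoetherianRing S]

/-- `S` as a module over `R`, and the restriction of scalars of the `S`-module `S`. -/
noncomputable def scalarsSelfIso : ModuleCat.of R S ≅ (scalars R).obj (ModuleCat.of S S) where
  hom := ConcreteCategory.ofHom (C := ModuleCat R)
    { toFun := id, map_add' _ _ := rfl, map_smul' := Algebra.smul_def (A := S) }
  inv := ConcreteCategory.ofHom (C := ModuleCat R)
    { toFun := id, map_add' _ _ := rfl
      map_smul' r (x : S) := (Algebra.smul_def (A := S) r x).symm }

/-- If `T(S)` has finitely many associated primes then so does `T(R)`, for every Lyubeznik functor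
`T` over `R`. -/
theorem finite_associatedPrimes_lyubeznikFunctor (hpure : IsPureExtension R S) (T : List (Factor R))
    (h : (associatedPrimes S ((lyubeznikFunctor (T.map (Factor.baseChange S))).obj
      (ModuleCat.of S S))).Finite) :
    (associatedPrimes R ((lyubeznikFunctor T).obj (ModuleCat.of R R))).Finite := by
  have := preservesColimitsOfShape_lyubeznikFunctor (J := FGSubmodule R S) T
  obtain ⟨e⟩ := nonempty_scalars_lyubeznikFunctor_iso R T (ModuleCat.of S S)
  have e' := e ≪≫ (lyubeznikFunctor T).mapIso scalarsSelfIso.symm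
  refine (h.image (Ideal.comap (algebraMap R S))).subset ?_
  refine (associatedPrimes.subset_of_injective (hpure.injective_map (lyubeznikFunctor T))).trans ?_
  rw [← LinearEquiv.AssociatedPrimes.eq e'.toLinearEquiv]
  exact associatedPrimes_scalars_subset R _

omit [IsNoetherianRing R] [IsNoetherianRing S] in
theorem preimage_zeroLocus (I : Ideal R) :
    preimage S ⟨PrimeSpectrum.zeroLocus (I : Set R), PrimeSpectrum.isClosed_zeroLocus _⟩ =
      ⟨PrimeSpectrum.zeroLocus (I.map (algebraMap R S) : Set S),
        PrimeSpectrum.isClosed_zeroLocus _⟩ :=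
  Closeds.ext ((PrimeSpectrum.preimage_comap_zeroLocus (algebraMap R S) I).trans
    (PrimeSpectrum.zeroLocus_span _).symm)

theorem finite_associatedPrimes_idealCohomology (hpure : IsPureExtension R S) (i : ℕ)
    (h : ∀ J : Ideal S, (associatedPrimes S (idealCohomology J i (ModuleCat.of S S))).Finite)
    (I : Ideal R) : (associatedPrimes R (idealCohomology I i (ModuleCat.of R R))).Finite := by
  refine finite_associatedPrimes_lyubeznikFunctor hpure [Factor.coh _ i] ?_
  have hJ := h (I.map (algebraMap R S))
  rw [idealCohomology, ← preimage_zeroLocus] at hJ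
  exact hJ

end Finiteness

end Lyubeznik

theorem theorem4p1 (R S : Type u) [CommRing R] [CommRing S] [IsNoetherianRing R]
    [IsNoetherianRing S] [Algebra R S] (hpure : Lyubeznik.IsPureExtension R S) :
    (IsLocalRing R →
      (∀ T : List (Lyubeznik.Factor R),
        (associatedPrimes S ((Lyubeznik.lyubeznikFunctor
          (T.map (Lyubeznik.Factor.baseChange S))).obj (ModuleCat.of S S))).Finite →
        (associatedPrimes R
          ((Lyubeznik.lyubeznikFunctor T).obj (ModuleCat.of R R))).Finite) ∧
      (∀ i : ℕ,
        (∀ J : Ideal S,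
          (associatedPrimes S (Lyubeznik.idealCohomology J i (ModuleCat.of S S))).Finite) →
        ∀ I : Ideal R,
          (associatedPrimes R (Lyubeznik.idealCohomology I i (ModuleCat.of R R))).Finite)) ∧
    (∀ i : ℕ,
      (∀ J : Ideal S,
        (associatedPrimes S (Lyubeznik.idealCohomology J i (ModuleCat.of S S))).Finite) →
      ∀ I : Ideal R,
        (associatedPrimes R (Lyubeznik.idealCohomology I i (ModuleCat.of R R))).Finite) := by
  have h := fun i => Lyubeznik.finite_associatedPrimes_idealCohomology hpure i
  exact ⟨fun _ => ⟨Lyubeznik.finite_associatedPrimes_lyubeznikFunctor hpure, h⟩, h⟩
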